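/- Let $n\ge 1$ and let $U=\mathcal U(osp(1|2n))$ be the universal enveloping superalgebra over $\mathbb C$ of $osp(1|2n)$, i.e. the associative unital algebra with fermionic generators $\sigma_a$ and bosonic generators $\sigma_{ab}$ ($a,b\in\{1,\dots,n,\bar 1,\dots,\bar n\}$, $\bar\alpha=\alpha+n$) and relations $$\{\sigma_a,\sigma_b\}=\sigma_{ab},\qquad [\sigma_a,\sigma_{bc}]=-g_{ab}\sigma_c-g_{ac}\sigma_b,\qquad [\sigma_{ab},\sigma_{cd}]=-g_{ac}\sigma_{bd}-g_{ad}\sigma_{bc}-g_{bc}\sigma_{ad}-g_{bd}\sigma_{ac},$$ where $(g_{ab})=\begin{pmatrix}0&-I_n\\ I_n&0\end{pmatrix}$. Put $[a_1\cdots a_p]=\sum_{s\in\mathfrak S_p}\varepsilon(s)\,\sigma_{a_{s(1)}}\cdots\sigma_{a_{s(p)}}$ (equal to $1$ for $p=0$), let $\Omega\subset U$ be the linear span of the $[a_1\cdots a_p]$, $0\le p\le 2n$, and for $0\le k\le n$ let $$A^{(n)}_{2n-2k}=\sum_{1\le\alpha_1<\dots<\alpha_{n-k}\le n}[\alpha_1\,\bar\alpha_1\cdots\alpha_{n-k}\,\bar\alpha_{n-k}].$$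 The Scasimir $S\!c^{(n)}$ is the element of $\Omega$ that anticommutes with all fermionic generators and commutes with all bosonic generators, normalized by $S\!c^{(n)}=[1\,\bar 1\,2\,\bar 2\cdots n\,\bar n]+{}$(a linear combination of brackets $[a_1\cdots a_p]$ with $p<2n$). **Theorem.** For every $n\ge1$ there is exactly one such element, and it is $$S\!c^{(n)}=\sum_{k=0}^n x^{(n)}_k A^{(n)}_{2n-2k},\qquad x^{(n)}_k=2^{-k}\,k!\,\binom{2n}{2k}\left.\frac{d^{2k}}{du^{2k}}\left(\frac{u}{\sinh u}\right)^{2n+1}\right|_{u=0},$$ where $u/\sinh u$ is given the value $1$ at $u=0$. The coefficients in this expansion are unique: if $\sum_{k=0}^n c_kA^{(n)}_{2n-2k}=S\!c^{(n)}$ with $c_k\in\mathbb C$, then $c_k=x_k^{(n)}$ for all $0\le k\le n$. In particular $$\begin{aligned} S\!c^{(1)}&=A^{(1)}_2-\tfrac12A^{(1)}_0=[1\bar1]-\tfrac12=\sigma_1\sigma_{\bar1}-\sigma_{\bar1}\sigma_1-\tfrac12,\\ S\!c^{(2)}&=A^{(2)}_4-5A^{(2)}_2+\tfrac92A^{(2)}_0=[1\bar12\bar2]-5\left([1\bar1]+[2\bar2]\right)+\tfrac92,\\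 S\!c^{(3)}&=A^{(3)}_6-\tfrac{35}2A^{(3)}_4+\tfrac{259}2A^{(3)}_2-\tfrac{675}4A^{(3)}_0\\ &=[1\bar12\bar23\bar3]-\tfrac{35}2\left([1\bar12\bar2]+[1\bar13\bar3]+[2\bar23\bar3]\right)+\tfrac{259}2\left([1\bar1]+[2\bar2]+[3\bar3]\right)-\tfrac{675}4,\\ S\!c^{(4)}&=A^{(4)}_8-42A^{(4)}_6+987A^{(4)}_4-9687A^{(4)}_2+\tfrac{33075}2A^{(4)}_0,\\ S\!c^{(5)}&=A^{(5)}_{10}-\tfrac{165}2A^{(5)}_8+4389A^{(5)}_6-\tfrac{259215}2A^{(5)}_4+\tfrac{3171663}2A^{(5)}_2-\tfrac{13395375}4A^{(5)}_0. \end{aligned}$$ -/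

import Mathlib

noncomputable section

namespace Osp

/-- The index set `{1, …, n} ∪ {1̄, …, n̄}` with `2n` elements: `Sum.inl α` is the index `α`,
`Sum.inr α` is the conjugated index `ᾱ`. -/
abbrev Idx (n : ℕ) : Type := Fin n ⊕ Fin n

/-- The `2n × 2n` matrix `g` with blocks `0, -I, I, 0`. -/
def g (n : ℕ) : Matrix (Idx n) (Idx n) ℂ := Matrix.fromBlocks 0 (-1) 1 0

/-- The generators of `osp(1|2n)`: fermionic `σ_a` and bosonic `σ_{ab}`. -/
inductive Gen (n : ℕ) : Type
  | fermion (a : Idx n) : Gen n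
  | boson (a b : Idx n) : Gen n

/-- The free associative complex algebra on the generators of `osp(1|2n)`. -/
abbrev Free (n : ℕ) : Type := FreeAlgebra ℂ (Gen n)

/-- The generator `σ_a` in the free algebra. -/
def fF {n : ℕ} (a : Idx n) : Free n := FreeAlgebra.ι ℂ (Gen.fermion a)

/-- The generator `σ_{ab}` in the free algebra. -/
def fB {n : ℕ} (a b : Idx n) : Free n := FreeAlgebra.ι ℂ (Gen.boson a b)

/-- The defining relations of `osp(1|2n)`: the superbracket is the anticommutator on two
fermionic generators, and the commutator otherwise. -/
inductive Rel (n : ℕ) : Free n → Free n → Prop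
  | fermion_fermion (a b : Idx n) :
      Rel n (fF a * fF b + fF b * fF a) (fB a b)
  | fermion_boson (a b c : Idx n) :
      Rel n (fF a * fB b c - fB b c * fF a) (-(g n a b • fF c) - g n a c • fF b)
  | boson_boson (a b c d : Idx n) :
      Rel n (fB a b * fB c d - fB c d * fB a b)
        (-(g n a c • fB b d) - g n a d • fB b c - g n b c • fB a d - g n b d • fB a c)

/-- The universal enveloping superalgebra `U(osp(1|2n))` over `ℂ`. -/
abbrev U (n : ℕ) : Type := RingQuot (Rel n)

/-- The fermionic generator `σ_a` of `U(osp(1|2n))`. -/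
def σ {n : ℕ} (a : Idx n) : U n := RingQuot.mkAlgHom ℂ (Rel n) (fF a)

/-- The bosonic generator `σ_{ab}` of `U(osp(1|2n))`. -/
def σσ {n : ℕ} (a b : Idx n) : U n := RingQuot.mkAlgHom ℂ (Rel n) (fB a b)

/-- The antisymmetric polynomial
`[a₁ … a_p] = ∑ₛ ε(s) σ_{a_{s(1)}} ⋯ σ_{a_{s(p)}}`, `s` running over the permutations of `p`
elements; the empty bracket is `1`. -/
def bracket {n : ℕ} (l : List (Idx n)) : U n :=
  ∑ s : Equiv.Perm (Fin l.length),
    (Equiv.Perm.sign s : ℤ) • (List.ofFn fun i => σ (l.get (s i))).prod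

/-- The subspace `Ω` of `U(osp(1|2n))` spanned by the `[a₁ … a_p]` with `p ≤ 2n`. -/
def Ω (n : ℕ) : Submodule ℂ (U n) :=
  Submodule.span ℂ {x | ∃ l : List (Idx n), l.length ≤ 2 * n ∧ x = bracket l}

/-- The subspace of `Ω` spanned by the terms of lower order, `[a₁ … a_p]` with `p < 2n`. -/
def ΩLower (n : ℕ) : Submodule ℂ (U n) :=
  Submodule.span ℂ {x | ∃ l : List (Idx n), l.length < 2 * n ∧ x = bracket l}

/-- For `S = {α₁ < ⋯ < α_m}` the list `α₁, ᾱ₁, …, α_m, ᾱ_m` (`List.finRange n` is increasing). -/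
def pairs {n : ℕ} (S : Finset (Fin n)) : List (Idx n) :=
  ((List.finRange n).filter (· ∈ S)).flatMap fun α => [Sum.inl α, Sum.inr α]

/-- `A n m` is `A^{(n)}_{2m}`: the sum of the brackets `[α₁ ᾱ₁ … α_m ᾱ_m]` over all
`α₁ < ⋯ < α_m` in `{1, …, n}`, that is, `n - m` pairs of conjugated indices are missing. -/
def A (n m : ℕ) : U n :=
  ∑ S ∈ (Finset.univ : Finset (Fin n)).powersetCard m, bracket (pairs S)

/-- `s` is the Scasimir of `U(osp(1|2n))`: the element of `Ω` that anticommutes with the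
fermionic generators and commutes with the bosonic ones, normalized as
`[1 1̄ 2 2̄ … n n̄] + lower order terms`. -/
structure IsScasimir (n : ℕ) (s : U n) : Prop where
  mem : s ∈ Ω n
  anticomm : ∀ a : Idx n, σ a * s + s * σ a = 0
  comm : ∀ a b : Idx n, σσ a b * s - s * σσ a b = 0
  leading : s - bracket (pairs (Finset.univ : Finset (Fin n))) ∈ ΩLower n

/-- The function `u / sinh u`, with its removable singularity at `0` filled in. -/
def uDivSinh (u : ℝ) : ℝ := if u = 0 then 1 else u / Real.sinh u

/-- `x_k^{(n)} = 2^{-k} k! (2n choose 2k) (d/du)^{2k} (u / sinh u)^{2n+1}` at `u = 0`. -/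
def x (n k : ℕ) : ℝ :=
  (2 : ℝ)⁻¹ ^ k * (k.factorial : ℝ) * ((2 * n).choose (2 * k) : ℝ) *
    iteratedDeriv (2 * k) (fun u : ℝ => uDivSinh u ^ (2 * n + 1)) 0

end Osp

end

/-! Existence. Let θ_b be Grassmann variables commuting with U, and put Q = ∑ θ_b σ_b and w = ∑ g_ab
θ_a θ_b, where w is central. Since Q^p = ∑ θ_v ⊗ σ_v over words v of length p, Grassmann derivatives
of Q^p read off the brackets. The Berezin integral over all variables sends w^k Q^(2n-2k) to (-2)^k
k! A_{2n-2k}: each factor w uses up a conjugated pair, in k! possible orders.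

Put F_n = ∏ (Q² + c² w), c = 1/2, 3/2, …, n - 1/2. The defining relations give ∂_a(Q F_n) = (n +
1/2)(σ_a F_n + F_n σ_a) (`apply_mul_oddSqProd`). The integral of a derivative is zero, so ∫ F_n
anticommutes with every σ_a, hence commutes with every σ_ab = {σ_a, σ_b}. Its coefficients are
(-2)^k k! e_k(1/4, 9/4, …), with e_k elementary symmetric. They equal x_k because a differential
equation linking consecutive odd powers of u / sinh u has, at the level of Taylor coefficients, the
recurrence of the e_k (`choose_mul_iteratedDeriv_uDivSinh_pow`).

Uniqueness. The difference d of two Scasimirs is a combination of brackets of length < 2n that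
anticommutes with every σ_a, and its top part is shown to vanish degree by degree. If the degree p
is even, an index a missing from the word l makes the coefficient of [a l] in {σ_a, d} a nonzero
multiple of that of [l] in d. If p is odd, d commutes with ∑ σ_{αᾱ}, under which words of odd length
have odd, so nonzero, weight. Both steps need independence of brackets modulo shorter words. Instead
of a PBW theorem, dual functionals are built (`dual_spec`): the coproduct followed by the defining
representation has matrix entries that are antiderivations up to lower order, and these are iterated
and closed with the counit. The same functionals show that the A's are independent. -/

namespace Osp

/-! ### Taylor coefficients of the odd powers of u / sinh u. -/

/-- The coefficients of `∏ (z + c²)`, `c` running over `1/2, 3/2, …, (2n-1)/2`. -/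
noncomputable def oddSqCoeff : ℕ → ℕ → ℝ
  | _, 0 => 1
  | 0, _ + 1 => 0
  | n + 1, k + 1 => oddSqCoeff n (k + 1) + ((n : ℝ) + 1 / 2) ^ 2 * oddSqCoeff n k

theorem oddSqCoeff_zero_right (n : ℕ) : oddSqCoeff n 0 = 1 := by
  cases n <;> rfl

theorem oddSqCoeff_succ_succ (n k : ℕ) : oddSqCoeff (n + 1) (k + 1)
    = oddSqCoeff n (k + 1) + ((n : ℝ) + 1 / 2) ^ 2 * oddSqCoeff n k := rfl

theorem oddSqCoeff_eq_zero {n k : ℕ} (h : n < k) : oddSqCoeff n k = 0 := by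
  induction n generalizing k with
  | zero => obtain ⟨k, rfl⟩ := Nat.exists_eq_succ_of_ne_zero h.ne'; rfl
  | succ n ih =>
    obtain ⟨k, rfl⟩ := Nat.exists_eq_succ_of_ne_zero (Nat.ne_zero_of_lt h)
    rw [Nat.succ_eq_add_one, oddSqCoeff_succ_succ, ih (by omega), ih (by omega)]
    simp

theorem uDivSinh_mul_sinh (u : ℝ) : uDivSinh u * Real.sinh u = u := by
  unfold uDivSinh
  split_ifs with h
  · simp [h]
  · have : Real.sinh u ≠ 0 := by simpa [Real.sinh_eq_zero] using h
    field_simp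

/-- The function is the reciprocal of `dslope Real.sinh 0`, which is analytic and nowhere zero. The
exponent `⊤` is the analytic one, so it survives differentiation. -/
theorem contDiff_uDivSinh : ContDiff ℝ ⊤ uDivSinh := by
  have hd : ∀ u, uDivSinh u = (dslope Real.sinh 0 u)⁻¹ := by
    intro u
    by_cases h : u = 0
    · simp [h, uDivSinh]
    · simp [dslope_of_ne _ h, slope_def_field, uDivSinh, h]
  have hne : ∀ u, dslope Real.sinh 0 u ≠ 0 := by
    intro u
    by_cases h : u = 0
    · simp [h]
    · simp [dslope_of_ne _ h, slope_def_field, h, Real.sinh_eq_zero]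
  have han : ∀ u, AnalyticAt ℝ (dslope Real.sinh 0) u := by
    intro u
    by_cases h : u = 0
    · subst h
      obtain ⟨p, hp⟩ := (Real.analyticAt_sinh : AnalyticAt ℝ Real.sinh 0)
      exact ⟨_, hp.has_fpower_series_dslope_fslope⟩
    · have h1 : AnalyticAt ℝ (fun v : ℝ => Real.sinh v / v) u :=
        Real.analyticAt_sinh.div analyticAt_id h
      refine h1.congr ?_
      filter_upwards [isOpen_ne.mem_nhds h] with v hv
      have hv : v ≠ 0 := hv
      simp [dslope_of_ne _ hv, slope_def_field]
  rw [show uDivSinh = fun u => (dslope Real.sinh 0 u)⁻¹ from funext hd]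
  exact (contDiff_iff_contDiffAt.2 fun u => (han u).contDiffAt).inv hne

theorem differentiable_uDivSinh : Differentiable ℝ uDivSinh :=
  contDiff_uDivSinh.differentiable (by simp)

theorem contDiff_deriv_uDivSinh : ContDiff ℝ ⊤ (deriv uDivSinh) := by
  have := (contDiff_uDivSinh.of_le (show ((⊤ : WithTop ℕ∞) + 1 ≤ ⊤) by simp))
  exact (contDiff_succ_iff_deriv.1 this).2.2

theorem deriv_uDivSinh_mul_sinh (u : ℝ) :
    deriv uDivSinh u * Real.sinh u + uDivSinh u * Real.cosh u = 1 := by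
  have h1 := (differentiable_uDivSinh u).hasDerivAt.mul (Real.hasDerivAt_sinh u)
  have h2 : uDivSinh * Real.sinh = id := funext uDivSinh_mul_sinh
  rw [h2] at h1
  exact h1.unique (hasDerivAt_id u)

theorem deriv_deriv_uDivSinh_mul_sinh (u : ℝ) :
    deriv (deriv uDivSinh) u * Real.sinh u + 2 * deriv uDivSinh u * Real.cosh u
      + uDivSinh u * Real.sinh u = 0 := by
  have hd : DifferentiableAt ℝ (deriv uDivSinh) u :=
    contDiff_deriv_uDivSinh.differentiable (by simp) u
  have h1 := (hd.hasDerivAt.mul (Real.hasDerivAt_sinh u)).add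
    ((differentiable_uDivSinh u).hasDerivAt.mul (Real.hasDerivAt_cosh u))
  have h2 : deriv uDivSinh * Real.sinh + uDivSinh * Real.cosh = fun _ => 1 :=
    funext deriv_uDivSinh_mul_sinh
  rw [h2] at h1
  have := h1.unique (hasDerivAt_const u 1)
  linear_combination this

theorem deriv_uDivSinh_pow (r : ℕ) : deriv (fun u => uDivSinh u ^ (r + 1))
    = fun u => (r + 1) * uDivSinh u ^ r * deriv uDivSinh u := by
  funext u
  have := (differentiable_uDivSinh u).hasDerivAt.fun_pow (r + 1)
  simpa using this.deriv

theorem deriv_deriv_uDivSinh_pow (r : ℕ) (u : ℝ) :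
    deriv (deriv (fun u => uDivSinh u ^ (r + 1))) u
      = (r + 1) * (r * uDivSinh u ^ (r - 1) * deriv uDivSinh u * deriv uDivSinh u
        + uDivSinh u ^ r * deriv (deriv uDivSinh) u) := by
  rw [deriv_uDivSinh_pow]
  have h1 := ((differentiable_uDivSinh u).hasDerivAt.fun_pow r).const_mul ((r : ℝ) + 1)
  have hd : DifferentiableAt ℝ (deriv uDivSinh) u :=
    contDiff_deriv_uDivSinh.differentiable (by simp) u
  rw [(h1.fun_mul hd.hasDerivAt).deriv]
  ring

/-- The differential equation relating `(u / sinh u)^(r+1)` and `(u / sinh u)^(r+3)`. -/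
theorem uDivSinh_pow_ode (r : ℕ) (u : ℝ) :
    ((r : ℝ) + 1) * (r + 2) * uDivSinh u ^ (r + 3)
      = u * (u * deriv (deriv (fun u => uDivSinh u ^ (r + 1))) u)
        - 2 * (r + 1) * (u * deriv (fun u => uDivSinh u ^ (r + 1)) u)
        + (r + 1) * (r + 2) * uDivSinh u ^ (r + 1)
        - (r + 1) ^ 2 * (u * (u * uDivSinh u ^ (r + 1))) := by
  rw [deriv_deriv_uDivSinh_pow, deriv_uDivSinh_pow]
  -- With h = u / sinh u, the equation h sinh u = u and its first two derivatives eliminate u, h'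
  -- and h''; what remains follows from cosh² = sinh² + 1.
  have e0 := uDivSinh_mul_sinh u
  have e1 := deriv_uDivSinh_mul_sinh u
  have e2 := deriv_deriv_uDivSinh_mul_sinh u
  have e3 := Real.cosh_sq u
  -- The truncated exponent `r - 1` does no harm at r = 0, thanks to the factor r.
  have er : u * (r * uDivSinh u ^ (r - 1)) = r * Real.sinh u * uDivSinh u ^ r := by
    cases r with
    | zero => simp
    | succ r =>
      rw [Nat.add_sub_cancel]
      nth_rewrite 1 [← e0]
      ring
  set h := uDivSinh u
  set h1 := deriv uDivSinh u
  set h2 := deriv (deriv uDivSinh) u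
  set s := Real.sinh u
  set c := Real.cosh u
  set p := h ^ (r - 1)
  have ha : u * (u * ((r + 1) * (r * p * h1 * h1 + h ^ r * h2)))
      = (r + 1) * h ^ (r + 1) * (r * (s * h1) ^ 2 + h * s * (h2 * s)) := by
    have : u * (u * ((r + 1) * (r * p * h1 * h1 + h ^ r * h2)))
      = (r + 1) * (u * (u * (r * p)) * h1 ^ 2 + u * u * h ^ r * h2) := by ring
    rw [this, er, ← e0]
    ring
  have f1 : s * h1 = 1 - h * c := by linear_combination e1
  have f2 : h2 * s = - 2 * h1 * c - h * s := by linear_combination e2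
  have hb : h * s * (h2 * s) = -2 * h * c * (s * h1) - h ^ 2 * s ^ 2 := by rw [f2]; ring
  have hc : 2 * ((r : ℝ) + 1) * (u * ((r + 1) * h ^ r * h1))
      = 2 * (r + 1) ^ 2 * h ^ (r + 1) * (s * h1) := by rw [← e0]; ring
  have hu : (r + 1 : ℝ) ^ 2 * (u * (u * h ^ (r + 1))) = 
      (r + 1) ^ 2 * h ^ (r + 1) * (h ^ 2 * s ^ 2) := by
    rw [← e0]; ring
  rw [ha, hc, hu, hb, f1]
  linear_combination (-((r : ℝ) + 1) * (r + 2) * h ^ (r + 3)) * e3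

theorem iteratedDeriv_id_mul {g : ℝ → ℝ} (hg : ContDiff ℝ ⊤ g) (j : ℕ) :
    iteratedDeriv (j + 1) (fun u => u * g u)
      = fun u => u * iteratedDeriv (j + 1) g u + (j + 1) * iteratedDeriv j g u := by
  have hd : ∀ i u, HasDerivAt (iteratedDeriv i g) (iteratedDeriv (i + 1) g u) u := by
    intro i u
    rw [iteratedDeriv_succ]
    exact ((hg.differentiable_iteratedDeriv i (by exact WithTop.coe_lt_top _)) u).hasDerivAt
  induction j with
  | zero =>
    funext u
    have h0 := hd 0 u
    simp only [iteratedDeriv_zero, zero_add] at h0 ⊢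
    rw [iteratedDeriv_one, ((hasDerivAt_id' u).fun_mul h0).deriv]
    simp; ring
  | succ j ih =>
    rw [iteratedDeriv_succ, ih]
    funext u
    rw [(((hasDerivAt_id' u).fun_mul (hd (j + 1) u)).fun_add ((hd j u).const_mul _)).deriv]
    push_cast; ring

theorem iteratedDeriv_id_mul_zero {g : ℝ → ℝ} (hg : ContDiff ℝ ⊤ g) (j : ℕ) :
    iteratedDeriv j (fun u => u * g u) 0 = j * iteratedDeriv (j - 1) g 0 := by
  cases j with
  | zero => simp
  | succ j => rw [iteratedDeriv_id_mul hg]; simp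

/-- This is the differential equation `uDivSinh_pow_ode` differentiated j + 2 times at 0. The factor
(r-1-j)(r-j) is (j+2)(j+1) - 2(r+1)(j+2) + (r+1)(r+2). -/
theorem iteratedDeriv_uDivSinh_pow_recurrence (r j : ℕ) :
    ((r : ℝ) + 1) * (r + 2) * iteratedDeriv (j + 2) (fun u => uDivSinh u ^ (r + 3)) 0
      = ((r : ℝ) - 1 - j) * (r - j) * iteratedDeriv (j + 2) (fun u => uDivSinh u ^ (r + 1)) 0
        - (r + 1) ^ 2 * (j + 2) * (j + 1) * iteratedDeriv j (fun u => uDivSinh u ^ (r + 1)) 0 := by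
  set f : ℝ → ℝ := fun u => uDivSinh u ^ (r + 1) with hf
  have cf : ContDiff ℝ ⊤ f := contDiff_uDivSinh.pow _
  have cd : ∀ {g : ℝ → ℝ}, ContDiff ℝ ⊤ g → ContDiff ℝ ⊤ (deriv g) := fun hg =>
    (contDiff_succ_iff_deriv.1 (hg.of_le (show ((⊤ : WithTop ℕ∞) + 1 ≤ ⊤) by simp))).2.2
  have cu : ∀ {g : ℝ → ℝ}, ContDiff ℝ ⊤ g → ContDiff ℝ ⊤ (fun u => u * g u) :=
    fun hg => contDiff_id.mul hg
  have cc : ∀ (c : ℝ) {g : ℝ → ℝ}, ContDiff ℝ ⊤ g → ContDiff ℝ ⊤ (fun u => c * g u) :=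
    fun c _ hg => contDiff_const.mul hg
  have at0 : ∀ {g : ℝ → ℝ}, ContDiff ℝ ⊤ g → ContDiffAt ℝ (j + 2 : ℕ) g 0 :=
    fun hg => (hg.of_le le_top).contDiffAt
  have key : (fun u => ((r : ℝ) + 1) * (r + 2) * uDivSinh u ^ (r + 3))
      = fun u => u * (u * deriv (deriv f) u) - 2 * (r + 1) * (u * deriv f u)
        + (r + 1) * (r + 2) * f u - (r + 1) ^ 2 * (u * (u * f u)) :=
    funext fun u => uDivSinh_pow_ode r u
  have hcm : ∀ (c : ℝ) (g : ℝ → ℝ),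
      iteratedDeriv (j + 2) (fun u => c * g u) 0 = c * iteratedDeriv (j + 2) g 0 :=
    fun c g => by rw [iteratedDeriv_const_mul_field]
  rw [← hcm, key, iteratedDeriv_fun_sub, iteratedDeriv_fun_add, iteratedDeriv_fun_sub, hcm, hcm, hcm,
    iteratedDeriv_id_mul_zero, iteratedDeriv_id_mul_zero, iteratedDeriv_id_mul_zero,
    iteratedDeriv_id_mul_zero, iteratedDeriv_id_mul_zero]
  · simp only [Nat.add_sub_cancel, show j + 2 - 1 = j + 1 by omega, ← iteratedDeriv_succ']
    push_cast
    ring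
  all_goals
    first
    | exact cf
    | exact cu cf
    | exact cd cf
    | exact cd (cd cf)
    | exact cu (cd (cd cf))
    | exact at0 (cu (cu (cd (cd cf))))
    | exact at0 (cc _ (cu (cd cf)))
    | exact at0 (cc _ cf)
    | exact at0 (cc _ (cu (cu cf)))
    | exact at0 ((cu (cu (cd (cd cf)))).sub (cc _ (cu (cd cf))))
    | exact at0 (((cu (cu (cd (cd cf)))).sub (cc _ (cu (cd cf)))).add (cc _ cf))

/-- At r = 2n, j = 2k, binomial absorption (`c1`, `c2`) removes the k-dependent factors of the
recurrence. It becomes that of `oddSqCoeff`, with -(2n+1)² = -4 (n + 1/2)². -/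
theorem choose_mul_iteratedDeriv_uDivSinh_pow (n k : ℕ) :
    ((2 * n).choose (2 * k) : ℝ) * iteratedDeriv (2 * k) (fun u => uDivSinh u ^ (2 * n + 1)) 0
      = (-4) ^ k * oddSqCoeff n k := by
  induction n generalizing k with
  | zero =>
    cases k with
    | zero => simp [oddSqCoeff, uDivSinh]
    | succ k => simp [oddSqCoeff, Nat.choose_eq_zero_of_lt]
  | succ n ih =>
    cases k with
    | zero => simp [oddSqCoeff, uDivSinh]
    | succ k =>
      have hr := iteratedDeriv_uDivSinh_pow_recurrence (2 * n) (2 * k)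
      have i1 := ih (k + 1)
      have i2 := ih k
      rw [oddSqCoeff_succ_succ]
      rw [show 2 * (k + 1) = 2 * k + 2 by ring] at *
      rw [show 2 * (n + 1) = 2 * n + 2 by ring, show 2 * n + 2 + 1 = 2 * n + 3 by ring]
      set a := iteratedDeriv (2 * k + 2) (fun u => uDivSinh u ^ (2 * n + 3)) 0
      set b := iteratedDeriv (2 * k + 2) (fun u => uDivSinh u ^ (2 * n + 1)) 0
      set c := iteratedDeriv (2 * k) (fun u => uDivSinh u ^ (2 * n + 1)) 0
      have c2 : ((2 * n + 2).choose (2 * k + 2) : ℝ) * (2 * k + 2) * (2 * k + 1)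
          = (2 * n + 1) * (2 * n + 2) * ((2 * n).choose (2 * k)) := by
        have h1 := Nat.add_one_mul_choose_eq (2 * n + 1) (2 * k + 1)
        have h2 := Nat.add_one_mul_choose_eq (2 * n) (2 * k)
        have h1' := congrArg (Nat.cast : ℕ → ℝ) h1
        have h2' := congrArg (Nat.cast : ℕ → ℝ) h2
        push_cast at h1' h2'
        rw [show 2 * n + 1 + 1 = 2 * n + 2 by ring, show 2 * k + 1 + 1 = 2 * k + 2 by ring] at h1'
        linear_combination (-(2 * (k : ℝ) + 1)) * h1' - (2 * (n : ℝ) + 2) * h2'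
      have c1 : ((2 * n + 2).choose (2 * k + 2) : ℝ) * ((2 * n - 1 - 2 * k) * (2 * n - 2 * k))
          = (2 * n + 1) * (2 * n + 2) * ((2 * n).choose (2 * k + 2)) := by
        rcases lt_trichotomy n k with h | h | h
        · rw [Nat.choose_eq_zero_of_lt (by omega), Nat.choose_eq_zero_of_lt (by omega)]; simp
        · subst h
          rw [Nat.choose_eq_zero_of_lt (show 2 * n < 2 * n + 2 by omega)]; simp
        · have h1 := Nat.choose_mul_succ_eq (2 * n) (2 * k + 2)
          have h2 := Nat.choose_mul_succ_eq (2 * n + 1) (2 * k + 2)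
          rw [← Nat.cast_inj (R := ℝ), Nat.cast_mul, Nat.cast_mul, Nat.cast_sub (by omega)] at h1 h2
          push_cast at h1 h2
          linear_combination (-(2 * (n : ℝ) + 2)) * h1 - (2 * (n : ℝ) - 1 - 2 * k) * h2
      have hpos : ((2 * n + 1) * (2 * n + 2) : ℝ) ≠ 0 := by positivity
      apply mul_left_cancel₀ hpos
      push_cast at hr
      rw [pow_succ] at i1 ⊢
      linear_combination ((2 * n + 2).choose (2 * k + 2) : ℝ) * hr + b * c1
        - (2 * n + 1) ^ 2 * c * c2 + (2 * (n : ℝ) + 1) * (2 * n + 2) * i1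
        - (2 * n + 1) ^ 2 * ((2 * (n : ℝ) + 1) * (2 * n + 2)) * i2

theorem x_eq_oddSqCoeff (n k : ℕ) : x n k = (-2) ^ k * k.factorial * oddSqCoeff n k := by
  rw [x, mul_assoc, choose_mul_iteratedDeriv_uDivSinh_pow]
  have : ((2 : ℝ)⁻¹) ^ k * (-4) ^ k = (-2) ^ k := by rw [← mul_pow]; norm_num
  linear_combination (k.factorial : ℝ) * oddSqCoeff n k * this

end Osp
-- The derivative identity for ∏ (Q² + c² w) in an abstract algebra.
noncomputable section

namespace Osp

section Recursion

variable {T : Type*} [Ring T] [Algebra ℂ T]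

/-- The product of the `Q² + c² w` for `c = 1/2, 3/2, …, (2n-1)/2`. -/
def oddSqProd (Q w : T) : ℕ → T
  | 0 => 1
  | n + 1 => (Q * Q + (((n : ℂ) + 1 / 2) ^ 2) • w) * oddSqProd Q w n

theorem oddSqProd_commute {Q w : T} (hw : Commute w Q) (n : ℕ) :
    Commute w (oddSqProd Q w n) ∧ Commute Q (oddSqProd Q w n) := by
  induction n with
  | zero => exact ⟨Commute.one_right _, Commute.one_right _⟩
  | succ n ih =>
    refine ⟨Commute.mul_right ?_ ih.1, Commute.mul_right ?_ ih.2⟩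
    · exact (hw.mul_right hw).add_right ((Commute.refl w).smul_right _)
    · exact ((Commute.refl Q).mul_right (Commute.refl Q)).add_right (hw.symm.smul_right _)

variable {Q w X B Θ : T} (hw : ∀ y, Commute w y) (hX : Q * X = B - X * Q)
  (hB : Q * B = -(B * Q) - Θ * Q - w * X) (hΘ : Q * Θ = -(Θ * Q))

include hw hX hB in
theorem sq_mul_of_relations : Q * Q * X = X * (Q * Q) - (2 : ℂ) • (B * Q) - Θ * Q - X * w := by
  rw [mul_assoc, hX, mul_sub, hB, ← mul_assoc, hX, (hw X).eq, sub_mul, mul_assoc]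
  module

include hw hX hB hΘ in
theorem sq_mul_of_relations' : Q * Q * B
    = B * (Q * Q) + (2 : ℂ) • (Θ * (Q * Q)) + (2 : ℂ) • (X * (Q * w)) - B * w := by
  rw [mul_assoc, hB, mul_sub, mul_sub, mul_neg, ← mul_assoc, ← mul_assoc, hB, hΘ, (hw X).eq,
    ← mul_assoc, hX]
  simp only [sub_mul, neg_mul, mul_assoc, (hw Q).eq]
  module

include hw hX hB hΘ in
-- Carrying X to the left through n + 1 factors costs only one of them: the result is an explicit
-- quadratic expression times the product of n factors. The half-integers c are what makes this
-- recursion close.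
theorem oddSqProd_succ_mul (n : ℕ) : oddSqProd Q w (n + 1) * X
    = (X * (Q * Q) - (((n : ℂ) + 1 / 2) * (n + 3 / 2)) • (X * w) - (2 * (n : ℂ) + 2) • (B * Q)
      - (((n : ℂ) + 1 / 2) * (2 * n + 2)) • (Θ * Q)) * oddSqProd Q w n := by
  have h1 := sq_mul_of_relations hw hX hB
  have h2 := sq_mul_of_relations' hw hX hB hΘ
  have h3 : Q * Q * Θ = Θ * (Q * Q) := by
    rw [mul_assoc, hΘ, mul_neg, ← mul_assoc, hΘ, neg_mul, neg_neg, mul_assoc]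
  induction n with
  | zero =>
    simp only [oddSqProd, mul_one, add_mul, h1, smul_mul_assoc, (hw X).eq]
    push_cast
    module
  | succ n ih =>
    rw [oddSqProd, mul_assoc, ih, oddSqProd, ← mul_assoc, ← mul_assoc _ _ (oddSqProd Q w n)]
    -- With the n-fold product cancelled, the factor with c = n + 3/2 stands on the left of one side
    -- and the factor with c = n + 1/2 on the right of the other.
    congr 1
    have hwQ : ∀ y, w * (Q * y) = Q * (w * y) := fun y => by
      rw [← mul_assoc, (hw Q).eq, mul_assoc]
    simp only [mul_sub, add_mul, mul_add, smul_mul_assoc, mul_smul_comm]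
    simp only [← mul_assoc (Q * Q), h1, h2, h3]
    simp only [← mul_assoc w, (hw X).eq, (hw B).eq, (hw Θ).eq]
    simp only [add_mul, sub_mul, smul_mul_assoc, mul_assoc, (hw Q).eq, smul_sub, smul_add,
      smul_smul, hwQ]
    push_cast
    module

include hw hX hB hΘ in
-- Here d models ∂_a, X is σ_a, B is ∑ θ_b σ_ab and Θ is ∑ g_ca θ_c. In the induction step `hFX`
-- rewrites Q²FX; the terms w F X then cancel and both sides are left multiples of F.
theorem apply_mul_oddSqProd {d : T →ₗ[ℂ] T} (d1 : d 1 = 0) (dQ : ∀ y, d (Q * y) = X * y - Q * d y)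
    (dw : ∀ y, d (w * y) = -((2 : ℂ) • (Θ * y)) + w * d y) (n : ℕ) :
    d (Q * oddSqProd Q w n)
      = ((n : ℂ) + 1 / 2) • (X * oddSqProd Q w n + oddSqProd Q w n * X) := by
  induction n with
  | zero => simp only [oddSqProd, dQ, d1]; push_cast; simp; module
  | succ n ih =>
    have hF := (oddSqProd_commute (hw Q) n)
    have hL := oddSqProd_succ_mul hw hX hB hΘ n
    rw [oddSqProd] at hL ⊢
    set F := oddSqProd Q w n
    have hFX : Q * (Q * (F * X)) = (X * (Q * Q) - (((n : ℂ) + 1 / 2) * (n + 3 / 2)) • (X * w)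
        - (2 * (n : ℂ) + 2) • (B * Q) - (((n : ℂ) + 1 / 2) * (2 * n + 2)) • (Θ * Q)) * F
        - (((n : ℂ) + 1 / 2) ^ 2) • (w * (F * X)) := by
      rw [← hL]; simp only [add_mul, smul_mul_assoc, mul_assoc]; module
    have e1 : Q * ((Q * Q + (((n : ℂ) + 1 / 2) ^ 2) • w) * F)
        = Q * (Q * (Q * F)) + (((n : ℂ) + 1 / 2) ^ 2) • (w * (Q * F)) := by
      simp only [add_mul, mul_add, smul_mul_assoc, mul_smul_comm, mul_assoc]
      rw [← mul_assoc Q w, ← (hw Q).eq, mul_assoc]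
    rw [e1, map_add, map_smul, dw, dQ, dQ, ih]
    have hX' : ∀ y, Q * (X * y) = B * y - X * (Q * y) := fun y => by
      rw [← mul_assoc, hX, sub_mul, mul_assoc]
    have hB' : ∀ y, Q * (B * y) = -(B * (Q * y)) - Θ * (Q * y) - X * (w * y) := fun y => by
      rw [← mul_assoc, hB, (hw X).eq]; simp only [sub_mul, neg_mul, mul_assoc]
    have hw' : ∀ y, w * (X * y) = X * (w * y) := fun y => by
      rw [← mul_assoc, (hw X).eq, mul_assoc]
    simp only [add_mul, sub_mul, mul_add, mul_sub, smul_mul_assoc, mul_smul_comm, mul_assoc,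
      smul_add, smul_sub, hX', hFX, hB', hw']
    push_cast
    module

end Recursion

end Osp
end
-- Words, iterated antiderivations and antisymmetrization.
noncomputable section

namespace Osp

section Words

variable {I R : Type*} [Ring R]

/-- The product `f (v 0) ⋯ f (v (p - 1))`. -/
def word (f : I → R) {p : ℕ} (v : Fin p → I) : R := (List.ofFn fun i => f (v i)).prod

theorem word_zero (f : I → R) (v : Fin 0 → I) : word f v = 1 := by simp [word]

theorem word_succ (f : I → R) {p : ℕ} (v : Fin (p + 1) → I) :
    word f v = f (v 0) * word f (fun i => v i.succ) := by simp [word, List.ofFn_succ]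

variable [Algebra ℂ R]

/-- The functional `ε ∘ D (l (p - 1)) ∘ ⋯ ∘ D (l 0)`. -/
def iter (D : I → R →ₗ[ℂ] R) (ε : R →ₗ[ℂ] ℂ) : (p : ℕ) → (Fin p → I) → R →ₗ[ℂ] ℂ
  | 0, _ => ε
  | p + 1, l => iter D ε p (fun i => l i.succ) ∘ₗ D (l 0)

variable [DecidableEq I] {f : I → R} {D : I → R →ₗ[ℂ] R} {ε : R →ₗ[ℂ] ℂ} {L : ℕ → Submodule ℂ R}

/-- `L p` holds the error terms. Iterating the rule for the first letter gives the alternating sum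
over deleted letters, modulo errors. -/
theorem antiderivation_word (hL : ∀ a p, ∀ y ∈ L p, f a * y ∈ L (p + 1))
    (hD : ∀ b p (v : Fin (p + 1) → I), D b (word f v) - ((if b = v 0 then 1 else 0 : ℂ) •
      word f (fun i => v i.succ) - f (v 0) * D b (word f (fun i => v i.succ))) ∈ L p)
    (h1 : ∀ b, D b 1 = 0) (b : I) {p : ℕ} (v : Fin (p + 1) → I) :
    D b (word f v) - ∑ j : Fin (p + 1), ((-1) ^ (j : ℕ) * (if b = v j then 1 else 0 : ℂ)) •
      word f (fun i => v (j.succAbove i)) ∈ L p := by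
  induction p with
  | zero =>
    have := hD b 0 v
    convert this using 1
    rw [Fin.sum_univ_succ]
    simp [word_zero, h1]
  | succ p ih =>
    have e1 := hD b (p + 1) v
    have e2 := hL (v 0) p _ (ih (fun i => v i.succ))
    refine (Submodule.sub_mem _ e1 e2 |> fun h => ?_)
    convert h using 1
    rw [Fin.sum_univ_succ]
    simp only [mul_sub, Finset.mul_sum, Fin.val_zero, pow_zero, one_mul, Fin.succAbove_zero,
      Fin.val_succ, pow_succ, mul_neg, mul_one, neg_mul, neg_smul, Finset.sum_neg_distrib]
    have : ∀ j : Fin (p + 1), word f (fun i => v (j.succ.succAbove i))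
        = f (v 0) * word f (fun i => v (j.succAbove i).succ) := by
      intro j
      rw [word_succ]
      simp
    simp only [this, mul_smul_comm]
    abel

/-- The alternating sum is Laplace expansion along the first row. The lemma serves twice: in the
Grassmann algebra with zero error, and in U with shorter words as error. -/
theorem iter_word (hL : ∀ a p, ∀ y ∈ L p, f a * y ∈ L (p + 1))
    (hD : ∀ b p (v : Fin (p + 1) → I), D b (word f v) - ((if b = v 0 then 1 else 0 : ℂ) •
      word f (fun i => v i.succ) - f (v 0) * D b (word f (fun i => v i.succ))) ∈ L p)
    (h1 : ∀ b, D b 1 = 0) (hDL : ∀ b p, ∀ y ∈ L (p + 1), D b y ∈ L p)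
    (h0 : ∀ y ∈ L 0, ε y = 0) (hε : ε 1 = 1) (p : ℕ) (l : Fin p → I) :
    (∀ y ∈ L p, iter D ε p l y = 0) ∧
    ∀ v : Fin p → I, iter D ε p l (word f v)
      = (Matrix.of fun i j => (if l i = v j then 1 else 0 : ℂ)).det := by
  induction p with
  | zero => exact ⟨h0, fun v => by simp [iter, word_zero, hε]⟩
  | succ p ih =>
    obtain ⟨ih1, ih2⟩ := ih (fun i => l i.succ)
    refine ⟨fun y hy => ih1 _ (hDL _ _ _ hy), fun v => ?_⟩
    have := ih1 _ (antiderivation_word hL hD h1 (l 0) v)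
    rw [map_sub, sub_eq_zero] at this
    rw [iter, LinearMap.comp_apply, this, map_sum, Matrix.det_succ_row_zero]
    refine Finset.sum_congr rfl fun j _ => ?_
    rw [map_smul, ih2, smul_eq_mul]
    rfl

end Words

section Bracket

variable {n : ℕ}

/-- The antisymmetrized product of the `σ (v i)`. -/
def antisymm {p : ℕ} (v : Fin p → Idx n) : U n :=
  ∑ s : Equiv.Perm (Fin p), (Equiv.Perm.sign s : ℤ) • word σ (v ∘ s)

theorem bracket_eq_antisymm (l : List (Idx n)) : bracket l = antisymm l.get := rfl

/-- The determinant of `(δ_{l i, v j})`. -/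
def deltaDet {p : ℕ} (l v : Fin p → Idx n) : ℂ :=
  (Matrix.of fun i j => (if l i = v j then 1 else 0 : ℂ)).det

/-- In the Leibniz formula the term of s survives only for v = l ∘ s. -/
theorem sum_deltaDet_smul {M : Type*} [AddCommGroup M] [Module ℂ M] {p : ℕ} (l : Fin p → Idx n)
    (f : (Fin p → Idx n) → M) : ∑ v, deltaDet l v • f v
      = ∑ s : Equiv.Perm (Fin p), ((Equiv.Perm.sign s : ℤ) : ℂ) • f (l ∘ s) := by
  simp only [deltaDet, Matrix.det_apply, Matrix.of_apply, Finset.sum_smul]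
  rw [Finset.sum_comm]
  refine Finset.sum_congr rfl fun s _ => ?_
  rw [Finset.sum_eq_single (l ∘ s)]
  · simp [Units.smul_def]
  · intro v _ hv
    obtain ⟨i, hi⟩ := Function.ne_iff.1 hv
    rw [Finset.prod_eq_zero (Finset.mem_univ i)]
    · simp
    · simp only [ite_eq_right_iff]
      intro h
      exact absurd h.symm hi
  · simp

theorem antisymm_eq_sum {p : ℕ} (l : Fin p → Idx n) :
    (antisymm l : U n) = ∑ v, deltaDet l v • word σ v := by
  refine Eq.trans ?_ (sum_deltaDet_smul l (word σ)).symm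
  exact Finset.sum_congr rfl fun s _ => (Int.cast_smul_eq_zsmul ℂ _ _).symm

end Bracket

section Relations

variable {n : ℕ}

theorem σ_anticomm (a b : Idx n) : σ a * σ b + σ b * σ a = σσ a b := by
  simpa [σ, σσ] using RingQuot.mkAlgHom_rel ℂ (Rel.fermion_fermion a b)

theorem σ_comm_σσ (a b c : Idx n) :
    σ a * σσ b c - σσ b c * σ a = -(g n a b • σ c) - g n a c • σ b := by
  simpa [σ, σσ] using RingQuot.mkAlgHom_rel ℂ (Rel.fermion_boson a b c)

theorem g_antisymm (a b : Idx n) : g n a b = - g n b a := by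
  rcases a with a | a <;> rcases b with b | b <;>
    simp [g, Matrix.one_apply, eq_comm]

theorem g_inl_inr (a b : Fin n) : g n (Sum.inl a) (Sum.inr b) = if a = b then -1 else 0 := by
  simp [g, Matrix.one_apply]; split_ifs <;> simp

theorem g_inr_inl (a b : Fin n) : g n (Sum.inr a) (Sum.inl b) = if a = b then 1 else 0 := by
  simp [g, Matrix.one_apply]

theorem g_inl_inl (a b : Fin n) : g n (Sum.inl a) (Sum.inl b) = 0 := by simp [g]

theorem g_inr_inr (a b : Fin n) : g n (Sum.inr a) (Sum.inr b) = 0 := by simp [g]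

end Relations

end Osp
end
-- The Grassmann algebra, its invariant two-form and Berezin integrals.
noncomputable section

namespace Osp

open TensorProduct

/-- The Grassmann algebra on generators indexed by `Idx n`. -/
abbrev Grassmann (n : ℕ) : Type := ExteriorAlgebra ℂ (Idx n → ℂ)

variable {n : ℕ}

/-- The Grassmann variables. -/
def θ (a : Idx n) : Grassmann n := ExteriorAlgebra.ι ℂ (Pi.single a 1)

/-- The antiderivation `∂/∂θ_a`. -/
def dθ (a : Idx n) : Grassmann n →ₗ[ℂ] Grassmann n :=
  CliffordAlgebra.contractLeft (LinearMap.proj a : (Idx n → ℂ) →ₗ[ℂ] ℂ)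

theorem dθ_θ_mul (a b : Idx n) (y : Grassmann n) :
    dθ a (θ b * y) = (if a = b then (1 : ℂ) else 0) • y - θ b * dθ a y := by
  have := CliffordAlgebra.contractLeft_ι_mul (Q := (0 : QuadraticForm ℂ (Idx n → ℂ)))
    (d := LinearMap.proj a) (Pi.single b 1) y
  rw [LinearMap.proj_apply, Pi.single_apply] at this
  exact this

theorem dθ_one (a : Idx n) : dθ a (1 : Grassmann n) = 0 := CliffordAlgebra.contractLeft_one ..

theorem dθ_dθ (a : Idx n) (y : Grassmann n) : dθ a (dθ a y) = 0 :=
  CliffordAlgebra.contractLeft_contractLeft ..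

theorem dθ_comm (a b : Idx n) (y : Grassmann n) : dθ a (dθ b y) = -dθ b (dθ a y) :=
  CliffordAlgebra.contractLeft_comm ..

theorem θ_mul_θ (a b : Idx n) : (θ a * θ b : Grassmann n) = -(θ b * θ a) :=
  eq_neg_of_add_eq_zero_left (ExteriorAlgebra.ι_add_mul_swap ..)

theorem commute_θ_mul_θ (a b : Idx n) (y : Grassmann n) : Commute (θ a * θ b) y := by
  induction y using ExteriorAlgebra.induction with
  | algebraMap r => exact Algebra.commute_algebraMap_right r _
  | ι v =>
    have h : ∀ c : Idx n, ExteriorAlgebra.ι ℂ v * θ c = -(θ c * ExteriorAlgebra.ι ℂ v) := fun c =>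
      eq_neg_of_add_eq_zero_left (ExteriorAlgebra.ι_add_mul_swap ..)
    rw [Commute, SemiconjBy, ← mul_assoc, h, neg_mul, mul_assoc, mul_assoc, h, mul_neg, neg_neg]
  | mul x y hx hy => exact hx.mul_right hy
  | add x y hx hy => exact hx.add_right hy

/-- The constant term of an element of the Grassmann algebra. -/
def constTerm : Grassmann n →ₗ[ℂ] ℂ := (ExteriorAlgebra.algebraMapInv).toLinearMap

theorem constTerm_θ_mul (a : Idx n) (y : Grassmann n) : constTerm (θ a * y) = 0 := by
  have : ExteriorAlgebra.algebraMapInv (θ a) = (0 : ℂ) := by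
    simp [ExteriorAlgebra.algebraMapInv, θ]
  simp [constTerm, this]

theorem constTerm_one : constTerm (1 : Grassmann n) = 1 := by simp [constTerm]

theorem iter_word_θ {p : ℕ} (l v : Fin p → Idx n) : iter dθ constTerm p l (word θ v)
    = deltaDet l v := by
  refine (iter_word (L := fun _ => ⊥) (f := θ) ?_ ?_ dθ_one ?_ ?_ constTerm_one p l).2 v
  · rintro a p y hy; rw [Submodule.mem_bot] at hy ⊢; simp [hy]
  · intro b p v; rw [Submodule.mem_bot, word_succ, dθ_θ_mul, sub_self]
  · rintro a p y hy; rw [Submodule.mem_bot] at hy ⊢; simp [hy]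
  · rintro y hy; rw [Submodule.mem_bot] at hy; simp [hy]

/-! The invariant two-form and the Berezin integrals over the pairs of conjugated variables. -/

/-- The two-form `∑ g_ab θ_a θ_b`. -/
def twoForm (n : ℕ) : Grassmann n := ∑ a, ∑ b, g n a b • (θ a * θ b)

theorem commute_twoForm (y : Grassmann n) : Commute (twoForm n) y :=
  Commute.sum_left _ _ _ fun _ _ => Commute.sum_left _ _ _ fun _ _ =>
    (commute_θ_mul_θ _ _ y).smul_left _

theorem twoForm_eq : twoForm n = (-2 : ℂ) • ∑ α : Fin n, θ (Sum.inl α) * θ (Sum.inr α) := by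
  simp only [twoForm, Fintype.sum_sum_type, g_inl_inl, g_inr_inr, g_inl_inr, g_inr_inl, zero_smul,
    zero_add, add_zero, ite_smul, Finset.sum_ite_eq, Finset.mem_univ,
    if_true, Finset.smul_sum, ← Finset.sum_add_distrib]
  refine Finset.sum_congr rfl fun α _ => ?_
  rw [θ_mul_θ (Sum.inr α)]
  module

theorem dθ_twoForm_mul (a : Idx n) (y : Grassmann n) : dθ a (twoForm n * y)
    = -((2 : ℂ) • ((∑ c, g n c a • θ c) * y)) + twoForm n * dθ a y := by
  have h : ∀ c b : Idx n, dθ a (θ c * θ b * y) = (if a = c then (1 : ℂ) else 0) • (θ b * y)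
      - (if a = b then (1 : ℂ) else 0) • (θ c * y) + θ c * θ b * dθ a y := by
    intro c b
    rw [mul_assoc, dθ_θ_mul, dθ_θ_mul, mul_sub, mul_smul_comm, mul_assoc]
    abel
  simp only [twoForm, Finset.sum_mul, map_sum, smul_mul_assoc, map_smul, h, smul_add, smul_sub,
    Finset.sum_add_distrib, Finset.sum_sub_distrib, Finset.smul_sum]
  congr 1
  have h1 : ∑ c, ∑ b, g n c b • (if a = c then (1 : ℂ) else 0) • (θ b * y)
      = -∑ c, g n c a • (θ c * y) := by
    rw [Finset.sum_eq_single a]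
    · simp [g_antisymm a]
    · intro c _ hc; simp [hc.symm]
    · simp
  have h2 : ∑ c, ∑ b, g n c b • (if a = b then (1 : ℂ) else 0) • (θ c * y)
      = ∑ c, g n c a • (θ c * y) := by
    refine Finset.sum_congr rfl fun c _ => ?_
    rw [Finset.sum_eq_single a]
    · simp
    · intro c _ hc; simp [hc.symm]
    · simp
  rw [h1, h2, ← Finset.smul_sum]
  module

/-- The second derivative in the pair of conjugated variables `θ_α`, `θ_ᾱ`. -/
def dPair (α : Fin n) : Module.End ℂ (Grassmann n) := dθ (Sum.inr α) ∘ₗ dθ (Sum.inl α)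

theorem dPair_commute (α β : Fin n) : Commute (dPair α) (dPair β) := by
  refine LinearMap.ext fun y => ?_
  simp only [dPair, Module.End.mul_apply, LinearMap.comp_apply]
  rw [dθ_comm (Sum.inl α), dθ_comm (Sum.inl α), map_neg, dθ_comm (Sum.inr α),
    map_neg, map_neg, dθ_comm (Sum.inr α)]
  simp

/-- The two signs from passing two odd derivatives cancel. -/
theorem dPair_commute_mulLeft (α : Fin n) (c : Idx n) (h : c ≠ Sum.inl α) (h' : c ≠ Sum.inr α) :
    Commute (LinearMap.mulLeft ℂ (θ c : Grassmann n)) (dPair α) := by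
  refine LinearMap.ext fun y => ?_
  simp only [dPair, Module.End.mul_apply, LinearMap.comp_apply, LinearMap.mulLeft_apply]
  rw [dθ_θ_mul, if_neg h.symm, zero_smul, zero_sub, map_neg, dθ_θ_mul, if_neg h'.symm]
  simp

/-- The product of the operators `dPair α` for `α ∈ S`. -/
def dPairs (S : Finset (Fin n)) : Module.End ℂ (Grassmann n) :=
  S.noncommProd dPair fun α _ β _ _ => dPair_commute α β

/-- The Berezin integral over the variables with index in `S`, at zero in the others. -/
def berezin (S : Finset (Fin n)) : Grassmann n →ₗ[ℂ] ℂ := constTerm ∘ₗ dPairs S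

theorem berezin_of_mem {S : Finset (Fin n)} {α : Fin n} (h : α ∈ S) (y : Grassmann n) :
    berezin S y = berezin (S.erase α) (dPair α y) := by
  have := Finset.noncommProd_erase_mul S h dPair (fun α _ β _ _ => dPair_commute α β)
  rw [berezin, dPairs, ← this]
  rfl

theorem berezin_θ_mul {S : Finset (Fin n)} {c : Idx n} (h : ∀ α ∈ S, c ≠ Sum.inl α ∧ c ≠ Sum.inr α)
    (y : Grassmann n) : berezin S (θ c * y) = 0 := by
  have : Commute (LinearMap.mulLeft ℂ (θ c : Grassmann n)) (dPairs S) :=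
    Finset.noncommProd_commute _ _ _ _ fun α hα =>
      dPair_commute_mulLeft α c (h α hα).1 (h α hα).2
  have h2 := LinearMap.congr_fun this.eq y
  simp only [Module.End.mul_apply, LinearMap.mulLeft_apply] at h2
  rw [berezin, LinearMap.comp_apply, ← h2, constTerm_θ_mul]

theorem berezin_pair_mul (S : Finset (Fin n)) (β : Fin n) (y : Grassmann n) :
    berezin S (θ (Sum.inl β) * θ (Sum.inr β) * y) = if β ∈ S then berezin (S.erase β) y else 0 := by
  split_ifs with h
  · have hv : ∀ c : Idx n, (c = Sum.inl β ∨ c = Sum.inr β) →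
        ∀ z, berezin (S.erase β) (θ c * z) = 0 := by
      rintro c hc z
      refine berezin_θ_mul (fun α hα => ?_) z
      have := Finset.ne_of_mem_erase hα
      rcases hc with rfl | rfl <;> simp [this.symm]
    rw [berezin_of_mem h, dPair, LinearMap.comp_apply, mul_assoc, dθ_θ_mul, dθ_θ_mul]
    simp only [if_true, one_smul, reduceCtorEq, if_false, zero_smul, zero_sub, mul_neg, sub_neg_eq_add,
      map_add, dθ_θ_mul, map_sub]
    rw [hv _ (Or.inr rfl), map_neg, hv _ (Or.inl rfl)]
    simp
  · rw [mul_assoc]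
    refine berezin_θ_mul (fun α hα => ?_) _
    have : β ≠ α := fun e => h (e ▸ hα)
    simp [this]

theorem berezin_twoForm_mul (S : Finset (Fin n)) (y : Grassmann n) :
    berezin S (twoForm n * y) = -2 * ∑ α ∈ S, berezin (S.erase α) y := by
  rw [twoForm_eq, smul_mul_assoc, map_smul, Finset.sum_mul, map_sum, smul_eq_mul]
  simp only [berezin_pair_mul]
  simp

/-- Double counting: S' arises once for each α in S \ S'. -/
theorem sum_powersetCard_erase {ι M : Type*} [DecidableEq ι] [AddCommMonoid M] (S : Finset ι) (j : ℕ)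
    (f : Finset ι → M) : ∑ α ∈ S, ∑ S' ∈ (S.erase α).powersetCard j, f S'
      = (S.card - j) • ∑ S' ∈ S.powersetCard j, f S' := by
  rw [Finset.sum_comm' (t' := S.powersetCard j) (s' := fun S' => S \ S'), Finset.smul_sum]
  · refine Finset.sum_congr rfl fun S' hS' => ?_
    rw [Finset.mem_powersetCard] at hS'
    rw [Finset.sum_const, Finset.card_sdiff_of_subset hS'.1, hS'.2]
  · intro α S'
    simp only [Finset.mem_powersetCard, Finset.mem_sdiff, Finset.subset_erase]
    tauto

/-- Each two-form removes one pair with factor -2, and the k removed pairs can be removed in k!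
orders. -/
theorem berezin_twoForm_pow_mul (S : Finset (Fin n)) (k : ℕ) (hk : k ≤ S.card) (y : Grassmann n) :
    berezin S (twoForm n ^ k * y)
      = (-2) ^ k * k.factorial * ∑ S' ∈ S.powersetCard (S.card - k), berezin S' y := by
  induction k generalizing S with
  | zero => simp
  | succ k ih =>
    rw [pow_succ', mul_assoc, berezin_twoForm_mul]
    have : ∀ α ∈ S, berezin (S.erase α) (twoForm n ^ k * y) = (-2) ^ k * k.factorial *
        ∑ S' ∈ (S.erase α).powersetCard (S.card - (k + 1)), berezin S' y := by
      intro α hα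
      have hc := Finset.card_erase_of_mem hα
      rw [ih _ (by omega), hc, show S.card - 1 - k = S.card - (k + 1) by omega]
    rw [Finset.sum_congr rfl this, ← Finset.mul_sum, sum_powersetCard_erase,
      show S.card - (S.card - (k + 1)) = k + 1 by omega, Nat.factorial_succ, nsmul_eq_mul]
    push_cast
    ring

/-- The integral already differentiates in θ_a, and ∂_a² = 0. -/
theorem berezin_univ_dθ (a : Idx n) (y : Grassmann n) : berezin Finset.univ (dθ a y) = 0 := by
  rcases a with α | α
  · rw [berezin_of_mem (Finset.mem_univ α), dPair, LinearMap.comp_apply, dθ_dθ, map_zero, map_zero]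
  · rw [berezin_of_mem (Finset.mem_univ α), dPair, LinearMap.comp_apply, dθ_comm, map_neg, dθ_dθ,
      map_zero, map_zero, neg_zero]

theorem iter_flatMap (L : List (Fin n)) (hL : L.Nodup) :
    iter dθ constTerm _ (L.flatMap fun α => [Sum.inl α, Sum.inr α]).get = berezin L.toFinset := by
  induction L with
  | nil =>
    refine LinearMap.ext fun y => ?_
    simp only [berezin, dPairs, List.toFinset_nil, Finset.noncommProd_empty]
    rfl
  | cons α L ih =>
    obtain ⟨h1, h2⟩ := List.nodup_cons.1 hL
    refine LinearMap.ext fun y => ?_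
    have h3 : (insert α L.toFinset).erase α = L.toFinset :=
      Finset.erase_insert (by simpa using h1)
    rw [List.toFinset_cons, berezin_of_mem (Finset.mem_insert_self _ _), h3, ← ih h2]
    rfl

theorem iter_pairs (S : Finset (Fin n)) : iter dθ constTerm _ (pairs S).get = berezin S := by
  have h := iter_flatMap ((List.finRange n).filter (· ∈ S)) ((List.nodup_finRange n).filter _)
  have h2 : ((List.finRange n).filter (· ∈ S)).toFinset = S := by ext; simp
  rw [h2] at h
  exact h

theorem length_pairs (S : Finset (Fin n)) : (pairs S).length = 2 * S.card := by
  have h2 : ((List.finRange n).filter (· ∈ S)).toFinset = S := by ext; simp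
  have h3 := List.toFinset_card_of_nodup ((List.nodup_finRange n).filter (· ∈ S))
  rw [h2] at h3
  simp [pairs, h3, mul_comm]

end Osp
end
-- The generic element ∑ θ_b σ_b and the existence of the Scasimir.
noncomputable section

namespace Osp

open TensorProduct

variable {n : ℕ}

/-- The ordinary tensor product of the Grassmann algebra with the enveloping superalgebra: the
Grassmann variables commute with the generators. -/
abbrev GU (n : ℕ) : Type := Grassmann n ⊗[ℂ] U n

/-- The generic odd element `∑ θ_b σ_b`. -/
def gen (n : ℕ) : GU n := ∑ b : Idx n, θ b ⊗ₜ σ b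

/-- `∂/∂θ_a` on `GU n`. -/
def dGU (a : Idx n) : GU n →ₗ[ℂ] GU n := (dθ a).rTensor (U n)

theorem dGU_gen_mul (a : Idx n) (y : GU n) :
    dGU a (gen n * y) = (1 ⊗ₜ σ a) * y - gen n * dGU a y := by
  induction y using TensorProduct.induction_on with
  | zero => simp
  | tmul e u =>
    simp only [dGU, gen, Finset.sum_mul, Algebra.TensorProduct.tmul_mul_tmul, map_sum,
      LinearMap.rTensor_tmul, dθ_θ_mul, sub_tmul, Finset.sum_sub_distrib, one_mul]
    congr 1
    rw [Finset.sum_eq_single a]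
    · simp
    · intro b _ hb; simp [hb.symm]
    · simp
  | add y z hy hz => simp only [mul_add, map_add, hy, hz]; abel

theorem dGU_twoForm_mul (a : Idx n) (y : GU n) : dGU a ((twoForm n ⊗ₜ 1) * y)
    = -((2 : ℂ) • (((∑ c, g n c a • θ c) ⊗ₜ 1) * y)) + (twoForm n ⊗ₜ 1) * dGU a y := by
  induction y using TensorProduct.induction_on with
  | zero => simp
  | tmul e u =>
    simp only [dGU, Algebra.TensorProduct.tmul_mul_tmul, LinearMap.rTensor_tmul, dθ_twoForm_mul,
      add_tmul, neg_tmul, smul_tmul']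
  | add y z hy hz => simp only [mul_add, map_add, hy, hz, smul_add]; abel

theorem commute_twoForm_tmul_one (y : GU n) : Commute (twoForm n ⊗ₜ 1) y := by
  induction y using TensorProduct.induction_on with
  | zero => exact Commute.zero_right _
  | tmul e u =>
    simp [Commute, SemiconjBy, Algebra.TensorProduct.tmul_mul_tmul, (commute_twoForm e).eq]
  | add y z hy hz => exact hy.add_right hz

theorem gen_mul_σ (a : Idx n) :
    gen n * (1 ⊗ₜ σ a) = (∑ b, θ b ⊗ₜ σσ a b) - (1 ⊗ₜ σ a) * gen n := by
  simp only [gen, Finset.sum_mul, Finset.mul_sum, ← Finset.sum_sub_distrib,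
    Algebra.TensorProduct.tmul_mul_tmul, mul_one, one_mul, ← tmul_sub]
  refine Finset.sum_congr rfl fun b _ => ?_
  rw [← σ_anticomm, add_sub_cancel_left]

/-- The relation for [σ_c, σ_ab] is contracted with θ_c θ_b; exchanging the two θ's turns the
commutator into an anticommutator in the tensor product. -/
theorem gen_mul_σσ (a : Idx n) : gen n * (∑ b, θ b ⊗ₜ σσ a b) = -((∑ b, θ b ⊗ₜ σσ a b) * gen n)
    - ((∑ c, g n c a • θ c) ⊗ₜ 1) * gen n - (twoForm n ⊗ₜ 1) * (1 ⊗ₜ σ a) := by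
  have h1 : (∑ b, θ b ⊗ₜ[ℂ] σσ a b) * gen n
      = -∑ c, ∑ b, (θ c * θ b) ⊗ₜ[ℂ] (σσ a b * σ c) := by
    rw [gen, Finset.sum_mul_sum, Finset.sum_comm, ← Finset.sum_neg_distrib]
    refine Finset.sum_congr rfl fun c _ => ?_
    rw [← Finset.sum_neg_distrib]
    refine Finset.sum_congr rfl fun b _ => ?_
    rw [Algebra.TensorProduct.tmul_mul_tmul, θ_mul_θ, neg_tmul]
  have h2 : ((∑ c, g n c a • θ c) ⊗ₜ[ℂ] (1 : U n)) * gen n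
      = ∑ c, ∑ b, (θ c * θ b) ⊗ₜ[ℂ] (g n c a • σ b) := by
    rw [gen, sum_tmul, Finset.sum_mul_sum]
    refine Finset.sum_congr rfl fun c _ => Finset.sum_congr rfl fun b _ => ?_
    rw [Algebra.TensorProduct.tmul_mul_tmul, smul_mul_assoc, smul_tmul, one_mul]
  have h3 : (twoForm n ⊗ₜ[ℂ] (1 : U n)) * (1 ⊗ₜ σ a)
      = ∑ c, ∑ b, (θ c * θ b) ⊗ₜ[ℂ] (g n c b • σ a) := by
    rw [Algebra.TensorProduct.tmul_mul_tmul, mul_one, one_mul, twoForm, sum_tmul]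
    refine Finset.sum_congr rfl fun c _ => ?_
    rw [sum_tmul]
    exact Finset.sum_congr rfl fun b _ => smul_tmul ..
  rw [h1, h2, h3, neg_neg, gen, Finset.sum_mul_sum]
  simp only [← Finset.sum_sub_distrib, Algebra.TensorProduct.tmul_mul_tmul, ← tmul_sub]
  refine Finset.sum_congr rfl fun c _ => Finset.sum_congr rfl fun b _ => ?_
  have := σ_comm_σσ c a b
  rw [sub_eq_iff_eq_add] at this
  rw [this]
  congr 1
  abel

theorem gen_mul_θ (a : Idx n) :
    gen n * ((∑ c, g n c a • θ c) ⊗ₜ 1) = -(((∑ c, g n c a • θ c) ⊗ₜ 1) * gen n) := by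
  rw [gen, Finset.sum_mul, Finset.mul_sum, ← Finset.sum_neg_distrib]
  refine Finset.sum_congr rfl fun b _ => ?_
  simp only [Algebra.TensorProduct.tmul_mul_tmul, mul_one, one_mul, Finset.mul_sum, Finset.sum_mul,
    mul_smul_comm, smul_mul_assoc, ← neg_tmul, ← Finset.sum_neg_distrib]
  congr 1
  refine Finset.sum_congr rfl fun c _ => ?_
  rw [θ_mul_θ, smul_neg]

/-- The map `GU n → U n` induced by a functional on the Grassmann algebra. -/
def evalGU (φ : Grassmann n →ₗ[ℂ] ℂ) : GU n →ₗ[ℂ] U n := TensorProduct.lift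
  (LinearMap.lsmul ℂ (U n) ∘ₗ φ)

theorem evalGU_tmul (φ : Grassmann n →ₗ[ℂ] ℂ) (e : Grassmann n) (u : U n) :
    evalGU φ (e ⊗ₜ u) = φ e • u := by simp [evalGU]

theorem evalGU_one_tmul_mul (φ : Grassmann n →ₗ[ℂ] ℂ) (u : U n) (y : GU n) :
    evalGU φ ((1 ⊗ₜ u) * y) = u * evalGU φ y := by
  induction y using TensorProduct.induction_on with
  | zero => simp
  | tmul e v => simp [evalGU_tmul]
  | add y z hy hz => simp only [mul_add, map_add, hy, hz]

theorem evalGU_mul_one_tmul (φ : Grassmann n →ₗ[ℂ] ℂ) (u : U n) (y : GU n) :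
    evalGU φ (y * (1 ⊗ₜ u)) = evalGU φ y * u := by
  induction y using TensorProduct.induction_on with
  | zero => simp
  | tmul e v => simp [evalGU_tmul]
  | add y z hy hz => simp only [add_mul, map_add, hy, hz]

theorem evalGU_berezin_dGU (a : Idx n) (y : GU n) :
    evalGU (berezin Finset.univ) (dGU a y) = 0 := by
  induction y using TensorProduct.induction_on with
  | zero => simp
  | tmul e v => simp [evalGU_tmul, dGU, berezin_univ_dθ]
  | add y z hy hz => simp only [map_add, hy, hz, add_zero]

theorem gen_pow (p : ℕ) : gen n ^ p = ∑ v : Fin p → Idx n, word θ v ⊗ₜ word σ v := by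
  induction p with
  | zero => simp [word_zero, Algebra.TensorProduct.one_def]
  | succ p ih =>
    rw [pow_succ', ih, gen, Finset.sum_mul_sum, ← (Fin.consEquiv fun _ => Idx n).sum_comp,
      Fintype.sum_prod_type]
    refine Finset.sum_congr rfl fun a _ => Finset.sum_congr rfl fun v _ => ?_
    simp [word_succ, Fin.consEquiv]

theorem evalGU_iter_gen_pow {p : ℕ} (l : Fin p → Idx n) :
    evalGU (iter dθ constTerm p l) (gen n ^ p) = antisymm l := by
  simp only [gen_pow, map_sum, evalGU_tmul, iter_word_θ, ← antisymm_eq_sum]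

theorem evalGU_berezin_gen_pow (S : Finset (Fin n)) :
    evalGU (berezin S) (gen n ^ (2 * S.card)) = bracket (pairs S) := by
  rw [← length_pairs, ← iter_pairs, evalGU_iter_gen_pow, bracket_eq_antisymm]

theorem evalGU_twoForm_pow_mul (k : ℕ) (hk : k ≤ n) (y : GU n) :
    evalGU (berezin Finset.univ) ((twoForm n ⊗ₜ 1) ^ k * y) = ((-2 : ℂ) ^ k * k.factorial) •
      ∑ S' ∈ (Finset.univ : Finset (Fin n)).powersetCard (n - k), evalGU (berezin S') y := by
  induction y using TensorProduct.induction_on with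
  | zero => simp
  | tmul e v =>
    rw [Algebra.TensorProduct.tmul_pow, Algebra.TensorProduct.tmul_mul_tmul, evalGU_tmul,
      berezin_twoForm_pow_mul _ _ (by simpa using hk)]
    simp [evalGU_tmul, ← Finset.sum_smul, smul_smul]
  | add y z hy hz => simp only [mul_add, map_add, hy, hz, smul_add, Finset.sum_add_distrib]

theorem evalGU_twoForm_pow_mul_gen_pow (k : ℕ) (hk : k ≤ n) :
    evalGU (berezin Finset.univ) ((twoForm n ⊗ₜ 1) ^ k * gen n ^ (2 * (n - k)))
      = ((-2 : ℂ) ^ k * k.factorial) • A n (n - k) := by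
  rw [evalGU_twoForm_pow_mul k hk, A]
  congr 1
  refine Finset.sum_congr rfl fun S hS => ?_
  rw [← (Finset.mem_powersetCard.1 hS).2, evalGU_berezin_gen_pow]

theorem oddSqProd_expand {T : Type*} [Ring T] [Algebra ℂ T] {Q w : T} (hw : ∀ y, Commute w y)
    (n : ℕ) : oddSqProd Q w n
      = ∑ k ∈ Finset.range (n + 1), (oddSqCoeff n k : ℂ) • (w ^ k * Q ^ (2 * (n - k))) := by
  induction n with
  | zero => simp [oddSqProd, oddSqCoeff]
  | succ n ih =>
    rw [oddSqProd, ih, add_mul, Finset.sum_range_succ' _ (n + 1)]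
    have h1 : Q * Q * ∑ k ∈ Finset.range (n + 1), (oddSqCoeff n k : ℂ) • (w ^ k * Q ^ (2 * (n - k)))
        = ∑ k ∈ Finset.range (n + 2), (oddSqCoeff n k : ℂ) • (w ^ k * Q ^ (2 * (n + 1 - k))) := by
      rw [Finset.sum_range_succ _ (n + 1), oddSqCoeff_eq_zero (Nat.lt_succ_self n), Finset.mul_sum]
      simp only [Complex.ofReal_zero, zero_smul, add_zero]
      refine Finset.sum_congr rfl fun k hk => ?_
      have : k ≤ n := Nat.lt_succ_iff.1 (Finset.mem_range.1 hk)
      rw [mul_smul_comm, ← mul_assoc, ← ((hw (Q * Q)).pow_left k).eq, mul_assoc,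
        show 2 * (n + 1 - k) = 2 * (n - k) + 1 + 1 by omega, pow_succ', pow_succ', mul_assoc]
    rw [h1, Finset.sum_range_succ' _ (n + 1), Finset.mul_sum, add_right_comm,
      ← Finset.sum_add_distrib]
    congr 1
    · refine Finset.sum_congr rfl fun k _ => ?_
      rw [oddSqCoeff_succ_succ, show n + 1 - (k + 1) = n - k by omega, pow_succ']
      simp only [smul_mul_assoc, mul_smul_comm, mul_assoc]
      push_cast
      module
    · rw [oddSqCoeff_zero_right, oddSqCoeff_zero_right]

/-- The explicit Scasimir. -/
def scasimir (n : ℕ) : U n := ∑ k ∈ Finset.range (n + 1), (x n k : ℂ) • A n (n - k)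

/-- The factor (-2)^k k! in `x` is exactly the Berezin constant of w^k, and the rest is the
coefficient of w^k Q^(2n-2k) in the product. -/
theorem scasimir_eq_evalGU (n : ℕ) : scasimir n
    = evalGU (berezin Finset.univ) (oddSqProd (gen n) (twoForm n ⊗ₜ 1) n) := by
  rw [oddSqProd_expand commute_twoForm_tmul_one, map_sum, scasimir]
  refine Finset.sum_congr rfl fun k hk => ?_
  rw [map_smul, evalGU_twoForm_pow_mul_gen_pow k (Nat.lt_succ_iff.1 (Finset.mem_range.1 hk)),
    x_eq_oddSqCoeff, smul_smul]
  congr 1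
  push_cast
  ring

/-- The derivative identity is integrated: its left side vanishes, and n + 1/2 ≠ 0 can be divided
out. -/
theorem σ_anticomm_scasimir (a : Idx n) : σ a * scasimir n + scasimir n * σ a = 0 := by
  have h := apply_mul_oddSqProd (d := dGU a) commute_twoForm_tmul_one (gen_mul_σ a) (gen_mul_σσ a)
    (gen_mul_θ a) (by simp [dGU, Algebra.TensorProduct.one_def, dθ_one]) (dGU_gen_mul a)
    (dGU_twoForm_mul a) n
  have h2 := congrArg (evalGU (berezin Finset.univ)) h
  rw [evalGU_berezin_dGU, map_smul, map_add, evalGU_one_tmul_mul, evalGU_mul_one_tmul,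
    ← scasimir_eq_evalGU] at h2
  have h3 : (n : ℂ) + 1 / 2 ≠ 0 := by
    have : (n : ℂ) + 1 / 2 = ((n + 1 / 2 : ℝ) : ℂ) := by push_cast; ring
    rw [this]
    exact_mod_cast (by positivity : (n + 1 / 2 : ℝ) ≠ 0)
  exact (smul_eq_zero.1 h2.symm).resolve_left h3

theorem σσ_comm_of_anticomm {s : U n} (h : ∀ a : Idx n, σ a * s + s * σ a = 0) (a b : Idx n) :
    σσ a b * s - s * σσ a b = 0 := by
  have : (σσ a b : U n) * s - s * σσ a b = σ a * (σ b * s + s * σ b) - (σ a * s + s * σ a) * σ b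
      + σ b * (σ a * s + s * σ a) - (σ b * s + s * σ b) * σ a := by
    rw [← σ_anticomm]
    simp only [mul_add, add_mul, mul_assoc]
    abel
  rw [this, h, h]
  simp

theorem A_mem_span {m r : ℕ} (h : 2 * m ≤ r) :
    A n m ∈ Submodule.span ℂ {x : U n | ∃ l : List (Idx n), l.length ≤ r ∧ x = bracket l} := by
  refine Submodule.sum_mem _ fun S hS => Submodule.subset_span ⟨pairs S, ?_, rfl⟩
  rw [length_pairs, (Finset.mem_powersetCard.1 hS).2]
  exact h

theorem isScasimir_scasimir (hn : 1 ≤ n) : IsScasimir n (scasimir n) where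
  mem := Submodule.sum_mem _ fun k _ => Submodule.smul_mem _ _ (A_mem_span (by omega))
  anticomm := σ_anticomm_scasimir
  comm := σσ_comm_of_anticomm σ_anticomm_scasimir
  leading := by
    have h0 : (x n 0 : ℂ) • A n (n - 0) = bracket (pairs Finset.univ) := by
      rw [x_eq_oddSqCoeff, oddSqCoeff_zero_right, A]
      have : (Finset.univ : Finset (Fin n)).powersetCard (n - 0) = {Finset.univ} := by
        have h := Finset.powersetCard_self (Finset.univ : Finset (Fin n))
        rwa [Finset.card_fin] at h
      rw [this]
      simp
    rw [scasimir, Finset.sum_range_succ', h0, add_sub_cancel_right]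
    refine Submodule.sum_mem _ fun k hk => Submodule.smul_mem _ _ ?_
    refine Submodule.span_mono ?_ (A_mem_span (le_refl (2 * (n - (k + 1)))))
    rintro _ ⟨l, hl, rfl⟩
    exact ⟨l, by omega, rfl⟩

end Osp
end
-- Homomorphisms out of U, and the matrices of the coproduct.
noncomputable section

namespace Osp

variable {n : ℕ}

section Lift

variable {R : Type*} [Ring R] [Algebra ℂ R]

/-- The algebra homomorphism given by elements with the relations of the fermionic generators. -/
def liftU (τ : Idx n → R) (h : ∀ a b c,
    τ a * (τ b * τ c + τ c * τ b) - (τ b * τ c + τ c * τ b) * τ a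
    = -(g n a b • τ c) - g n a c • τ b) : U n →ₐ[ℂ] R :=
  RingQuot.liftAlgHom ℂ ⟨FreeAlgebra.lift ℂ fun
    | Gen.fermion a => τ a
    | Gen.boson a b => τ a * τ b + τ b * τ a, by
    rintro _ _ (⟨a, b⟩ | ⟨a, b, c⟩ | ⟨a, b, c, d⟩)
    · simp [fF, fB]
    · simpa [fF, fB] using h a b c
    · simp only [fB, map_sub, map_mul, map_neg, map_smul, FreeAlgebra.lift_ι_apply]
      have h1 := h a c d
      have h2 := h b c d
      set w := τ c * τ d + τ d * τ c
      -- The boson-boson relation is the Leibniz rule for commutation with w, given the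
      -- fermion-boson relation.
      have : (τ a * τ b + τ b * τ a) * w - w * (τ a * τ b + τ b * τ a)
          = τ a * (τ b * w - w * τ b) + (τ a * w - w * τ a) * τ b
            + τ b * (τ a * w - w * τ a) + (τ b * w - w * τ b) * τ a := by
        simp only [mul_add, add_mul, mul_sub, sub_mul, mul_assoc]
        abel
      rw [this, h1, h2]
      simp only [mul_sub, sub_mul, mul_neg, neg_mul, mul_smul_comm, smul_mul_assoc]
      module⟩

theorem liftU_σ (τ : Idx n → R) (h) (a : Idx n) : liftU τ h (σ a) = τ a := by
  simp [liftU, σ, fF]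

end Lift

/-- The counit. -/
def counit : U n →ₐ[ℂ] ℂ := liftU (fun _ => 0) (by simp)

/-- The image of `σ_a` under the coproduct followed by the defining representation in the second
factor. -/
def coMat {R : Type*} [Ring R] [Algebra ℂ R] (τ : Idx n → R) (a : Idx n) :
    Matrix (Option (Idx n)) (Option (Idx n)) R
  | none, none => τ a
  | none, some b => -(g n a b • 1)
  | some b, none => (if b = a then (1 : ℂ) else 0) • 1
  | some b, some c => -((if b = c then (1 : ℂ) else 0) • τ a)

section CoMat

variable {R : Type*} [Ring R] [Algebra ℂ R] {τ : Idx n → R} {β : Idx n → Idx n → R}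

theorem mul_coMat_none (M : Matrix (Option (Idx n)) (Option (Idx n)) R) (a : Idx n) (i) :
    (M * coMat τ a) i none = M i none * τ a + M i (some a) := by
  rw [Matrix.mul_apply, Fintype.sum_option, Finset.sum_eq_single a]
  · simp [coMat]
  · intro b _ hb; simp [coMat, hb]
  · simp

theorem mul_coMat_some (M : Matrix (Option (Idx n)) (Option (Idx n)) R) (a e : Idx n) (i) :
    (M * coMat τ a) i (some e) = -(g n a e • M i none) - M i (some e) * τ a := by
  rw [Matrix.mul_apply, Fintype.sum_option, Finset.sum_eq_single e]
  · simp [coMat, sub_eq_add_neg]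
  · intro b _ hb; simp [coMat, hb]
  · simp

theorem coMat_mul_none (M : Matrix (Option (Idx n)) (Option (Idx n)) R) (a : Idx n) (j) :
    (coMat τ a * M) none j = τ a * M none j - ∑ c, g n a c • M (some c) j := by
  rw [Matrix.mul_apply, Fintype.sum_option, sub_eq_add_neg, ← Finset.sum_neg_distrib]
  congr 1
  refine Finset.sum_congr rfl fun c _ => ?_
  simp [coMat]

theorem coMat_mul_some (M : Matrix (Option (Idx n)) (Option (Idx n)) R) (a d : Idx n) (j) :
    (coMat τ a * M) (some d) j = (if d = a then (1 : ℂ) else 0) • M none j - τ a * M (some d) j := by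
  rw [Matrix.mul_apply, Fintype.sum_option, Finset.sum_eq_single d]
  · rw [coMat, coMat, smul_mul_assoc, one_mul, if_pos rfl, one_smul, neg_mul, sub_eq_add_neg]
  · intro b _ hb; simp [coMat, hb.symm]
  · simp

variable (hβ : ∀ a b, τ a * τ b + τ b * τ a = β a b)
  (h : ∀ a b c, τ a * β b c - β b c * τ a = -(g n a b • τ c) - g n a c • τ b)

include hβ in
theorem coMat_anticomm_none_none (a b : Idx n) :
    (coMat τ a * coMat τ b + coMat τ b * coMat τ a) none none = β a b := by
  rw [← hβ]
  simp only [Matrix.add_apply, mul_coMat_none]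
  simp only [coMat, g_antisymm a b]
  module

theorem coMat_anticomm_none_some (a b d : Idx n) :
    (coMat τ a * coMat τ b + coMat τ b * coMat τ a) none (some d) = 0 := by
  simp only [Matrix.add_apply, mul_coMat_some]
  simp only [coMat, neg_mul, smul_mul_assoc, one_mul]
  module

theorem coMat_anticomm_some_none (a b d : Idx n) :
    (coMat τ a * coMat τ b + coMat τ b * coMat τ a) (some d) none = 0 := by
  simp only [Matrix.add_apply, mul_coMat_none]
  simp only [coMat, smul_mul_assoc, one_mul]
  module

include hβ in
theorem coMat_anticomm_some_some (a b d e : Idx n) :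
    (coMat τ a * coMat τ b + coMat τ b * coMat τ a) (some d) (some e)
      = (if d = e then (1 : ℂ) else 0) • β a b - ((if d = a then (1 : ℂ) else 0) * g n b e
        + (if d = b then (1 : ℂ) else 0) * g n a e) • (1 : R) := by
  rw [← hβ]
  simp only [Matrix.add_apply, mul_coMat_some]
  simp only [coMat, neg_mul, smul_mul_assoc]
  module

include hβ h in
-- `coMat τ a` is τ_a times the parity matrix diag(1, -1) plus the odd matrix representing σ_a.
-- Parity anticommutes with odd matrices, so anticommutators have no mixed terms: they are β_ab
-- times the identity plus the matrix representing σ_ab.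
theorem coMat_relation (a b c : Idx n) :
    coMat τ a * (coMat τ b * coMat τ c + coMat τ c * coMat τ b)
      - (coMat τ b * coMat τ c + coMat τ c * coMat τ b) * coMat τ a
      = -(g n a b • coMat τ c) - g n a c • coMat τ b := by
  have hr := h a b c
  rw [sub_eq_iff_eq_add] at hr
  have hs : ∀ e : Idx n, ∑ d, g n a d • ((if d = e then (1 : ℂ) else 0) • β b c
      - ((if d = b then (1 : ℂ) else 0) * g n c e
        + (if d = c then (1 : ℂ) else 0) * g n b e) • (1 : R))
      = g n a e • β b c - (g n a b * g n c e + g n a c * g n b e) • (1 : R) := by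
    intro e
    simp only [smul_sub, smul_smul, add_smul, smul_add, Finset.sum_sub_distrib,
      Finset.sum_add_distrib, ← Finset.sum_smul, mul_ite, mul_one, one_mul, mul_zero, ite_mul,
      zero_mul, Finset.sum_ite_eq', Finset.mem_univ, if_true]
  ext i j
  rcases i with _ | i <;> rcases j with _ | j <;>
    simp only [Matrix.sub_apply, Matrix.neg_apply, Matrix.smul_apply, coMat_mul_none,
      coMat_mul_some, mul_coMat_none, mul_coMat_some, coMat_anticomm_none_none hβ,
      coMat_anticomm_none_some, coMat_anticomm_some_none, coMat_anticomm_some_some hβ, hs]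
  · simp only [coMat, hr, smul_zero, Finset.sum_const_zero]
    module
  · simp only [coMat]
    simp only [mul_zero, zero_mul]
    module
  · simp only [coMat, g_antisymm b a, g_antisymm c a]
    simp only [mul_zero, zero_mul]
    split_ifs <;> module
  · simp only [coMat, mul_sub, sub_mul, mul_smul_comm, smul_mul_assoc, hr, mul_one, one_mul]
    module

end CoMat

end Osp
end
-- Functionals dual to brackets, and uniqueness of the Scasimir.
noncomputable section

namespace Osp

variable {n : ℕ}

/-- The coproduct followed by the defining representation in the second factor. -/
def coprod : U n →ₐ[ℂ] Matrix (Option (Idx n)) (Option (Idx n)) (U n) :=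
  liftU (coMat σ) fun a b c => coMat_relation σ_anticomm σ_comm_σσ a b c

theorem coprod_σ (a : Idx n) : coprod (σ a : U n) = coMat σ a := liftU_σ ..

/-- A matrix coefficient of the coproduct, an antiderivation up to lower order terms. -/
def dU (b : Idx n) : U n →ₗ[ℂ] U n :=
  Matrix.entryLinearMap ℂ (U n) (some b) none ∘ₗ coprod.toLinearMap

theorem dU_apply (b : Idx n) (y : U n) : dU b y = coprod y (some b) none := rfl

theorem dU_σ_mul (a b : Idx n) (y : U n) : dU b (σ a * y)
    = (if b = a then (1 : ℂ) else 0) • coprod y none none - σ a * dU b y := by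
  rw [dU_apply, map_mul, coprod_σ, coMat_mul_some, dU_apply]

theorem coprod_σ_mul_none_none (a : Idx n) (y : U n) : coprod (σ a * y) none none
    = σ a * coprod y none none - ∑ c, g n a c • dU c y := by
  rw [map_mul, coprod_σ, coMat_mul_none]
  rfl

/-- The span of the words of length less than `p` in the fermionic generators. -/
def wordSpan (n p : ℕ) : Submodule ℂ (U n) :=
  Submodule.span ℂ {y | ∃ r < p, ∃ v : Fin r → Idx n, y = word σ v}

theorem word_mem_wordSpan {r p : ℕ} (h : r < p) (v : Fin r → Idx n) :
    word σ v ∈ wordSpan n p := Submodule.subset_span ⟨r, h, v, rfl⟩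

theorem wordSpan_mono {p q : ℕ} (h : p ≤ q) : wordSpan n p ≤ wordSpan n q :=
  Submodule.span_mono fun _ ⟨r, hr, v, hv⟩ => ⟨r, hr.trans_le h, v, hv⟩

/-- A linear map sends the span of short words to a submodule as soon as it does so for words. -/
theorem map_wordSpan_mem {M : Type*} [AddCommGroup M] [Module ℂ M] (φ : U n →ₗ[ℂ] M)
    (N : Submodule ℂ M) {p : ℕ} (h : ∀ r < p, ∀ v : Fin r → Idx n, φ (word σ v) ∈ N) :
    ∀ y ∈ wordSpan n p, φ y ∈ N := by
  suffices wordSpan n p ≤ N.comap φ from fun y hy => this hy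
  rw [wordSpan, Submodule.span_le]
  rintro _ ⟨r, hr, v, rfl⟩
  exact h r hr v

theorem σ_mul_mem_wordSpan (a : Idx n) (p : ℕ) (y : U n) (hy : y ∈ wordSpan n p) :
    σ a * y ∈ wordSpan n (p + 1) := by
  refine map_wordSpan_mem (LinearMap.mulLeft ℂ (σ a)) _ (fun r hr v => ?_) y hy
  have : (LinearMap.mulLeft ℂ (σ a)) (word σ v) = word σ (Fin.cons a v : Fin (r + 1) → Idx n) := by
    simp [word_succ]
  rw [this]
  exact word_mem_wordSpan (by omega) _

theorem word_mul_σ (a : Idx n) {p : ℕ} (v : Fin p → Idx n) :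
    word σ v * σ a = (word σ (Fin.snoc v a : Fin (p + 1) → Idx n) : U n) := by
  rw [word, word, List.ofFn_succ', List.concat_eq_append, List.prod_append]
  simp

theorem mul_σ_mem_wordSpan (a : Idx n) (p : ℕ) (y : U n) (hy : y ∈ wordSpan n p) :
    y * σ a ∈ wordSpan n (p + 1) := by
  refine map_wordSpan_mem (LinearMap.mulRight ℂ (σ a)) _ (fun r hr v => ?_) y hy
  rw [LinearMap.mulRight_apply, word_mul_σ]
  exact word_mem_wordSpan (by omega) _

theorem coprod_one_entries : coprod (1 : U n) none none = 1 ∧ ∀ b, dU b (1 : U n) = 0 := by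
  simp [dU_apply]

/-- To leading order the diagonal entry at `none` is the identity, and `dU b` lowers the length.
This is what makes `dU b` an antiderivation modulo shorter words. -/
theorem coprod_word {r : ℕ} (v : Fin r → Idx n) :
    coprod (word σ v) none none - word σ v ∈ wordSpan n r ∧
      ∀ b, dU b (word σ v) ∈ wordSpan n r := by
  induction r with
  | zero => simp [word_zero, coprod_one_entries]
  | succ r ih =>
    obtain ⟨h1, h2⟩ := ih (fun i => v i.succ)
    rw [word_succ]
    set y : U n := word σ (fun i => v i.succ)
    constructor
    · have : coprod (σ (v 0) * y) none none - σ (v 0) * y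
          = σ (v 0) * (coprod y none none - y) - ∑ c, g n (v 0) c • dU c y := by
        rw [coprod_σ_mul_none_none, mul_sub]; abel
      rw [this]
      refine Submodule.sub_mem _ (σ_mul_mem_wordSpan _ _ _ h1) (Submodule.sum_mem _ fun c _ => ?_)
      exact Submodule.smul_mem _ _ (wordSpan_mono (Nat.le_succ r) (h2 c))
    · intro b
      rw [dU_σ_mul]
      refine Submodule.sub_mem _ (Submodule.smul_mem _ _ ?_) (σ_mul_mem_wordSpan _ _ _ (h2 b))
      have := Submodule.add_mem _ (wordSpan_mono (Nat.le_succ r) h1)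
        (word_mem_wordSpan (Nat.lt_succ_self r) (fun i => v i.succ))
      rwa [sub_add_cancel] at this

/-- The functional dual to the antisymmetrized product of the `σ (l i)`. -/
def dual {p : ℕ} (l : Fin p → Idx n) : U n →ₗ[ℂ] ℂ := iter dU counit.toLinearMap p l

/-- The substitute for PBW: coefficients of the top antisymmetric part can be read off without
regard to shorter words. -/
theorem dual_spec {p : ℕ} (l : Fin p → Idx n) :
    (∀ y ∈ wordSpan n p, dual l y = 0) ∧ ∀ v : Fin p → Idx n, dual l (word σ v) = deltaDet l v := by
  refine iter_word (L := wordSpan n) σ_mul_mem_wordSpan ?_ coprod_one_entries.2 ?_ ?_ ?_ p l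
  · intro b p v
    have := (coprod_word (fun i => v i.succ)).1
    have key : ∀ (c : ℂ) (x y : U n), x - y ∈ wordSpan n p → c • x - c • y ∈ wordSpan n p :=
      fun c x y hxy => by
        convert Submodule.smul_mem _ c hxy using 1; module
    rw [word_succ, dU_σ_mul, sub_sub_sub_cancel_right]
    exact key _ _ _ this
  · intro b p y hy
    refine map_wordSpan_mem (dU b) _ (fun r hr v => ?_) y hy
    exact wordSpan_mono (Nat.lt_succ_iff.1 hr) ((coprod_word v).2 b)
  · intro y hy
    have : wordSpan n 0 = ⊥ := by simp [wordSpan]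
    rw [this, Submodule.mem_bot] at hy
    simp [hy]
  · simp

/-- Alternating families of coefficients. -/
def Alternating {p : ℕ} (C : (Fin p → Idx n) → ℂ) : Prop :=
  ∀ v (s : Equiv.Perm (Fin p)), C (v ∘ s) = (Equiv.Perm.sign s : ℤ) * C v

theorem Alternating.eq_zero {p : ℕ} {C : (Fin p → Idx n) → ℂ} (hC : Alternating C)
    {v : Fin p → Idx n} (hv : ¬ Function.Injective v) : C v = 0 := by
  simp only [Function.Injective, not_forall] at hv
  obtain ⟨i, j, hij, hne⟩ := hv
  have h1 := hC v (Equiv.swap i j)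
  have h2 : v ∘ Equiv.swap i j = v := by
    funext k
    simp only [Function.comp_apply, Equiv.swap_apply_def]
    split_ifs <;> simp_all
  rw [h2, Equiv.Perm.sign_swap hne] at h1
  have h3 : C v = -C v := by simpa using h1
  linear_combination h3 / 2

theorem Alternating.sum_deltaDet {p : ℕ} {C : (Fin p → Idx n) → ℂ} (hC : Alternating C)
    (l : Fin p → Idx n) : ∑ v, deltaDet l v * C v = p.factorial * C l := by
  have h := sum_deltaDet_smul l C
  simp only [smul_eq_mul] at h
  rw [h]
  have : ∀ s : Equiv.Perm (Fin p), ((Equiv.Perm.sign s : ℤ) : ℂ) * C (l ∘ s) = C l := by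
    intro s
    rw [hC, ← mul_assoc]
    rcases Int.units_eq_one_or (Equiv.Perm.sign s) with h | h <;> simp [h]
  simp [this, Fintype.card_perm]

theorem alternating_deltaDet {p : ℕ} (l : Fin p → Idx n) : Alternating (deltaDet l) := by
  intro v s
  exact Matrix.det_permute' s (Matrix.of fun i j => (if l i = v j then 1 else 0 : ℂ))

/-- The span of the brackets of length less than `p`. -/
def bracketSpan (n p : ℕ) : Submodule ℂ (U n) :=
  Submodule.span ℂ {y | ∃ l : List (Idx n), l.length < p ∧ y = bracket l}

theorem bracketSpan_le_wordSpan (p : ℕ) : bracketSpan n p ≤ wordSpan n p := by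
  rw [bracketSpan, Submodule.span_le]
  rintro _ ⟨l, hl, rfl⟩
  rw [bracket_eq_antisymm, antisymm_eq_sum]
  exact Submodule.sum_mem _ fun v _ => Submodule.smul_mem _ _ (word_mem_wordSpan hl v)

/-- Extracts the top-degree part as an alternating tensor C, the form in which `dual` recovers it up
to p!. -/
theorem exists_alternating_of_mem_bracketSpan {p : ℕ} {y : U n} (hy : y ∈ bracketSpan n (p + 1)) :
    ∃ C : (Fin p → Idx n) → ℂ, Alternating C ∧ y - ∑ v, C v • word σ v ∈ bracketSpan n p := by
  induction hy using Submodule.span_induction with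
  | mem y hy =>
    obtain ⟨l, hl, rfl⟩ := hy
    rcases Nat.lt_succ_iff_lt_or_eq.1 hl with h | rfl
    · refine ⟨0, fun v s => by simp, ?_⟩
      simp only [Pi.zero_apply, zero_smul, Finset.sum_const_zero, sub_zero]
      exact Submodule.subset_span ⟨l, h, rfl⟩
    · refine ⟨deltaDet l.get, alternating_deltaDet _, ?_⟩
      rw [bracket_eq_antisymm, antisymm_eq_sum, sub_self]
      exact zero_mem _
  | zero => exact ⟨0, fun v s => by simp, by simp⟩
  | add y z _ _ hy hz =>
    obtain ⟨C, hC, hCy⟩ := hy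
    obtain ⟨C', hC', hCz⟩ := hz
    refine ⟨C + C', fun v s => by simp [hC v s, hC' v s, mul_add], ?_⟩
    have := Submodule.add_mem _ hCy hCz
    simpa [add_smul, Finset.sum_add_distrib, add_sub_add_comm] using this
  | smul c y _ hy =>
    obtain ⟨C, hC, hCy⟩ := hy
    refine ⟨c • C, fun v s => by simp [hC v s, mul_left_comm], ?_⟩
    have := Submodule.smul_mem _ c hCy
    simpa [smul_sub, Finset.smul_sum, smul_smul] using this

theorem dual_of_alternating {p : ℕ} {C : (Fin p → Idx n) → ℂ} (hC : Alternating C)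
    (l : Fin p → Idx n) : dual l (∑ v, C v • word σ v) = p.factorial * C l := by
  rw [← hC.sum_deltaDet, map_sum]
  refine Finset.sum_congr rfl fun v _ => ?_
  rw [map_smul, (dual_spec l).2, smul_eq_mul, mul_comm]

theorem deltaDet_cons_cons {p : ℕ} {l : Fin p → Idx n} {a : Idx n} (ha : ∀ i, l i ≠ a)
    (v : Fin p → Idx n) :
    deltaDet (Fin.cons a l : Fin (p + 1) → Idx n) (Fin.cons a v : Fin (p + 1) → Idx n)
      = deltaDet l v := by
  rw [deltaDet, Matrix.det_succ_column_zero, Fin.sum_univ_succ]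
  simp only [Matrix.of_apply, Fin.cons_zero, Fin.cons_succ, ha, if_false, mul_zero, zero_mul,
    Finset.sum_const_zero, add_zero, Fin.val_zero, pow_zero, if_true, one_mul, Fin.succAbove_zero]
  rfl

theorem deltaDet_cons_snoc {p : ℕ} {l : Fin p → Idx n} {a : Idx n} (ha : ∀ i, l i ≠ a)
    (v : Fin p → Idx n) :
    deltaDet (Fin.cons a l : Fin (p + 1) → Idx n) (Fin.snoc v a : Fin (p + 1) → Idx n)
      = (-1) ^ p * deltaDet l v := by
  rw [deltaDet, Matrix.det_succ_column _ (Fin.last p), Fin.sum_univ_succ]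
  simp only [Matrix.of_apply, Fin.cons_zero, Fin.cons_succ, ha, if_false, mul_zero, zero_mul,
    Finset.sum_const_zero, add_zero, Fin.val_zero, if_true, Fin.succAbove_zero,
    Fin.snoc_last, Fin.val_last, zero_add, mul_one]
  congr 2
  ext i j
  simp

/-- Since p < 2n, some a is missing from l. The functional dual to [a l] gives p! C l on σ_a d and
(-1)^p p! C l on d σ_a; for even p these add up to 2 p! C l. -/
theorem coeff_eq_zero_of_even {p : ℕ} (hp : Even p) (hpn : p < 2 * n) {d : U n}
    {C : (Fin p → Idx n) → ℂ} (hC : Alternating C)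
    (hd : d - ∑ v, C v • word σ v ∈ wordSpan n p) (h : ∀ a : Idx n, σ a * d + d * σ a = 0)
    (l : Fin p → Idx n) : C l = 0 := by
  by_cases hl : Function.Injective l
  swap
  · exact hC.eq_zero hl
  obtain ⟨a, ha⟩ : ∃ a, ∀ i, l i ≠ a := by
    by_contra! hcon
    have := Fintype.card_le_of_surjective l hcon
    simp at this
    omega
  set z := d - ∑ v, C v • word σ v with hz
  have hdz : d = ∑ v, C v • word σ v + z := by rw [hz]; abel
  have h1 := congrArg (dual (Fin.cons a l : Fin (p + 1) → Idx n)) (h a)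
  rw [hdz, mul_add, add_mul, map_add, map_add, map_add, map_zero,
    (dual_spec _).1 _ (σ_mul_mem_wordSpan a p z hd), (dual_spec _).1 _ (mul_σ_mem_wordSpan a p z hd),
    add_zero, add_zero, Finset.mul_sum, Finset.sum_mul, map_sum, map_sum] at h1
  have h2 : ∀ v : Fin p → Idx n, dual (Fin.cons a l : Fin (p + 1) → Idx n)
      (σ a * (C v • word σ v)) = deltaDet l v * C v := by
    intro v
    have : σ a * (C v • word σ v : U n) = C v • word σ (Fin.cons a v : Fin (p + 1) → Idx n) := by
      simp [word_succ]
    rw [this, map_smul, (dual_spec _).2, deltaDet_cons_cons ha, smul_eq_mul, mul_comm]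
  have h3 : ∀ v : Fin p → Idx n, dual (Fin.cons a l : Fin (p + 1) → Idx n)
      ((C v • word σ v) * σ a) = deltaDet l v * C v := by
    intro v
    rw [smul_mul_assoc, word_mul_σ, map_smul, (dual_spec _).2, deltaDet_cons_snoc ha, smul_eq_mul,
      mul_comm, hp.neg_one_pow, one_mul]
  simp only [h2, h3, hC.sum_deltaDet] at h1
  have hf : (p.factorial : ℂ) ≠ 0 := by exact_mod_cast p.factorial_ne_zero
  have : (p.factorial : ℂ) * C l = 0 := by linear_combination h1 / 2
  exact (mul_eq_zero.1 this).resolve_left hf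

/-- The weight of an index under the sum of the `σ_{αᾱ}`. -/
def weight : Idx n → ℤ := Sum.elim (fun _ => -1) (fun _ => 1)

/-- The sum of the `σ_{αᾱ}`. -/
def cartan (n : ℕ) : U n := ∑ α : Fin n, σσ (Sum.inl α) (Sum.inr α)

theorem cartan_mul_σ (a : Idx n) : cartan n * σ a = σ a * cartan n + (weight a : ℂ) • σ a := by
  have h : ∀ α : Fin n, σσ (Sum.inl α) (Sum.inr α) * σ a = σ a * σσ (Sum.inl α) (Sum.inr α)
      + (g n a (Sum.inl α) • σ (Sum.inr α) + g n a (Sum.inr α) • σ (Sum.inl α)) := by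
    intro α
    have := σ_comm_σσ a (Sum.inl α) (Sum.inr α)
    rw [sub_eq_iff_eq_add] at this
    rw [this]
    abel
  rw [cartan, Finset.sum_mul, Finset.mul_sum, Finset.sum_congr rfl fun α _ => h α,
    Finset.sum_add_distrib]
  congr 1
  rcases a with a | a
  · simp [g_inl_inl, g_inl_inr, weight, ite_smul]
  · simp [g_inr_inl, g_inr_inr, weight, ite_smul]

theorem cartan_mul_word {p : ℕ} (v : Fin p → Idx n) : cartan n * word σ v
    = word σ v * cartan n + ((∑ i, weight (v i) : ℤ) : ℂ) • word σ v := by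
  induction p with
  | zero => simp [word_zero]
  | succ p ih =>
    rw [word_succ, ← mul_assoc, cartan_mul_σ, add_mul, mul_assoc, ih, Fin.sum_univ_succ]
    simp only [mul_add, mul_assoc, mul_smul_comm, smul_mul_assoc]
    push_cast
    module

/-- Commutation with `cartan n` multiplies each word by its total weight without changing its
length, so the top part of the commutator has coefficients weight · C. -/
theorem coeff_eq_zero_of_odd {p : ℕ} (hp : Odd p) {d : U n}
    {C : (Fin p → Idx n) → ℂ} (hC : Alternating C)
    (hd : d - ∑ v, C v • word σ v ∈ wordSpan n p) (h : cartan n * d - d * cartan n = 0)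
    (l : Fin p → Idx n) : C l = 0 := by
  set z := d - ∑ v, C v • word σ v with hz
  have hdz : d = ∑ v, C v • word σ v + z := by rw [hz]; abel
  let ad : U n →ₗ[ℂ] U n := LinearMap.mulLeft ℂ (cartan n) - LinearMap.mulRight ℂ (cartan n)
  have had : ∀ {r : ℕ} (v : Fin r → Idx n),
      ad (word σ v) = ((∑ i, weight (v i) : ℤ) : ℂ) • word σ v := by
    intro r v
    simp [ad, cartan_mul_word]
  have hadz : ad z ∈ wordSpan n p :=
    map_wordSpan_mem ad _ (fun r hr v => by
      rw [had]; exact Submodule.smul_mem _ _ (word_mem_wordSpan hr v)) z hd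
  have h1 : dual l (ad d) = 0 := by
    have : ad d = 0 := by simpa [ad] using h
    rw [this, map_zero]
  set C' : (Fin p → Idx n) → ℂ := fun v => C v * ((∑ i, weight (v i) : ℤ) : ℂ) with hC'
  have hA : Alternating C' := by
    intro v s
    have : ∑ i, weight ((v ∘ s) i) = ∑ i, weight (v i) :=
      Equiv.sum_comp s fun i => weight (v i)
    simp only [hC', this, hC v s, mul_assoc]
  have h2 : ad (∑ v, C v • word σ v) = ∑ v, C' v • word σ v := by
    rw [map_sum]
    refine Finset.sum_congr rfl fun v _ => ?_
    rw [map_smul, had, smul_smul]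
  rw [hdz, map_add, map_add, (dual_spec l).1 _ hadz, add_zero, h2, dual_of_alternating hA] at h1
  have hf : (p.factorial : ℂ) ≠ 0 := by exact_mod_cast p.factorial_ne_zero
  have h3 := (mul_eq_zero.1 h1).resolve_left hf
  refine (mul_eq_zero.1 h3).resolve_right ?_
  -- A sum of p terms ±1 has the parity of p.
  have hodd : Odd (∑ i, weight (l i)) := by
    have : ∀ i, weight (l i) = 1 + 2 * Sum.elim (fun _ => -1) (fun _ => 0) (l i) := by
      intro i
      rcases l i with a | a <;> rfl
    simp only [this, Finset.sum_add_distrib, ← Finset.mul_sum, Finset.sum_const, Finset.card_fin]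
    exact Odd.add_even (by simpa using hp) (even_two_mul _)
  have : (∑ i, weight (l i)) ≠ 0 := by
    intro h0
    rw [h0] at hodd
    exact absurd hodd (by decide)
  exact_mod_cast this

/-- The top degree is stripped off repeatedly. The bound 2n is essential: the Scasimir itself has
degree 2n. -/
theorem eq_zero_of_mem_bracketSpan {p : ℕ} (hp : p ≤ 2 * n) {d : U n} (hd : d ∈ bracketSpan n p)
    (h : ∀ a : Idx n, σ a * d + d * σ a = 0) : d = 0 := by
  induction p with
  | zero =>
    have : bracketSpan n 0 = ⊥ := by simp [bracketSpan]
    rwa [this, Submodule.mem_bot] at hd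
  | succ p ih =>
    obtain ⟨C, hC, hCd⟩ := exists_alternating_of_mem_bracketSpan hd
    have hw := bracketSpan_le_wordSpan p hCd
    have hcart : cartan n * d - d * cartan n = 0 := by
      rw [cartan, Finset.sum_mul, Finset.mul_sum, ← Finset.sum_sub_distrib]
      exact Finset.sum_eq_zero fun α _ => σσ_comm_of_anticomm h _ _
    have h0 : ∀ v, C v = 0 := by
      intro v
      rcases Nat.even_or_odd p with he | ho
      · exact coeff_eq_zero_of_even he (by omega) hC hw h v
      · exact coeff_eq_zero_of_odd ho hC hw hcart v
    refine ih (by omega) ?_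
    simpa [h0] using hCd

theorem IsScasimir.eq_scasimir (hn : 1 ≤ n) {s : U n} (hs : IsScasimir n s) : s = scasimir n := by
  have hc := isScasimir_scasimir hn
  rw [← sub_eq_zero]
  -- The leading brackets cancel in the difference, and `ΩLower n` unfolds to `bracketSpan n (2 *
  -- n)`.
  refine eq_zero_of_mem_bracketSpan (le_refl (2 * n)) ?_ fun a => ?_
  · have := Submodule.sub_mem _ hs.leading hc.leading
    rwa [sub_sub_sub_cancel_right] at this
  · have : σ a * (s - scasimir n) + (s - scasimir n) * σ a
        = (σ a * s + s * σ a) - (σ a * scasimir n + scasimir n * σ a) := by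
      simp only [mul_sub, sub_mul]; abel
    rw [this, hs.anticomm, hc.anticomm, sub_zero]

end Osp
end
-- Independence of the A's.
noncomputable section

namespace Osp

variable {n : ℕ}

theorem nodup_pairs (S : Finset (Fin n)) : (pairs S).Nodup := by
  rw [pairs, List.nodup_flatMap]
  refine ⟨fun α _ => by simp, ?_⟩
  refine ((List.nodup_finRange n).filter _).imp ?_
  intro α β hαβ
  simp [Function.onFun, List.disjoint_left, hαβ, Ne.symm]

theorem inl_mem_pairs (S : Finset (Fin n)) (α : Fin n) : Sum.inl α ∈ pairs S ↔ α ∈ S := by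
  simp [pairs]

theorem deltaDet_self {p : ℕ} {l : Fin p → Idx n} (hl : Function.Injective l) :
    deltaDet l l = 1 := by
  have : (Matrix.of fun i j => (if l i = l j then 1 else 0 : ℂ)) = 1 := by
    ext i j
    simp [Matrix.one_apply, hl.eq_iff]
  rw [deltaDet, this, Matrix.det_one]

theorem dual_bracket {l l' : List (Idx n)} (hlen : l'.length = l.length)
    (h : ∃ a ∈ l, a ∉ l') : dual l.get (bracket l') = 0 := by
  obtain ⟨a, hal, hal'⟩ := h
  obtain ⟨i, hi⟩ := List.mem_iff_get.1 hal
  have key : ∀ v : Fin l.length → Idx n, (∀ j, v j ≠ a) → dual l.get (antisymm v) = 0 := by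
    intro v hv
    rw [antisymm_eq_sum, dual_of_alternating (alternating_deltaDet v), deltaDet,
      Matrix.det_eq_zero_of_column_eq_zero i, mul_zero]
    intro j
    simp only [Matrix.of_apply, ite_eq_right_iff]
    intro h
    exact absurd (h.trans hi) (hv j)
  have hb : bracket l' = antisymm (fun j : Fin l.length => l'.get (j.cast hlen.symm)) := by
    rw [bracket_eq_antisymm]
    generalize hq : l.length = q at hlen
    subst hlen
    rfl
  rw [hb]
  exact key _ fun j hj => hal' (hj ▸ List.get_mem _ _)

theorem dual_bracket_self {l : List (Idx n)} (hl : l.Nodup) :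
    dual l.get (bracket l) = l.length.factorial := by
  rw [bracket_eq_antisymm, antisymm_eq_sum, dual_of_alternating (alternating_deltaDet _),
    deltaDet_self (List.nodup_iff_injective_get.1 hl), mul_one]

theorem dual_pairs_A (S : Finset (Fin n)) :
    dual (pairs S).get (A n S.card) = (pairs S).length.factorial := by
  rw [A, map_sum, Finset.sum_eq_single S, dual_bracket_self (nodup_pairs S)]
  · intro S' hS' hne
    rw [Finset.mem_powersetCard] at hS'
    refine dual_bracket (by rw [length_pairs, length_pairs, hS'.2]) ?_
    obtain ⟨α, hα, hα'⟩ : ∃ α ∈ S, α ∉ S' := by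
      by_contra! hcon
      exact hne (Finset.eq_of_subset_of_card_le hcon hS'.2.le).symm
    exact ⟨Sum.inl α, (inl_mem_pairs S α).2 hα, fun h => hα' ((inl_mem_pairs S' α).1 h)⟩
  · intro h
    simp [Finset.mem_powersetCard] at h

theorem dual_pairs_A_of_lt (S : Finset (Fin n)) {m : ℕ} (hm : m < S.card) :
    dual (pairs S).get (A n m) = 0 := by
  refine (dual_spec _).1 _ (bracketSpan_le_wordSpan _ ?_)
  refine Submodule.sum_mem _ fun S' hS' => Submodule.subset_span ⟨pairs S', ?_, rfl⟩
  rw [length_pairs, length_pairs, (Finset.mem_powersetCard.1 hS').2]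
  omega

/-- A triangular system: the functional of a set S with n - k elements kills the shorter A's, is
nonzero on the A of its own length, and the longer ones already have coefficient 0 by induction. -/
theorem coeff_eq_zero_of_sum_smul_A {c : ℕ → ℂ}
    (h : ∑ k ∈ Finset.range (n + 1), c k • A n (n - k) = 0) {k : ℕ} (hk : k ≤ n) : c k = 0 := by
  induction k using Nat.strong_induction_on with
  | _ k ih =>
  obtain ⟨S, -, hS⟩ := Finset.exists_subset_card_eq (s := (Finset.univ : Finset (Fin n)))
    (n := n - k) (by simp)
  have h1 := congrArg (dual (pairs S).get) h
  rw [map_sum, map_zero, Finset.sum_eq_single k, map_smul, ← hS, dual_pairs_A] at h1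
  · exact (smul_eq_zero.1 h1).resolve_right (by exact_mod_cast Nat.factorial_ne_zero _)
  · intro j hj hjk
    have hj' := Finset.mem_range.1 hj
    rcases lt_or_gt_of_ne hjk with hlt | hgt
    · rw [ih j hlt (by omega), zero_smul, map_zero]
    · rw [map_smul, dual_pairs_A_of_lt S (by omega), smul_zero]
  · intro hk'
    exact absurd (Finset.mem_range.2 (by omega)) hk'

theorem IsScasimir.coeff_eq (hn : 1 ≤ n) {c : ℕ → ℂ}
    (h : IsScasimir n (∑ k ∈ Finset.range (n + 1), c k • A n (n - k))) {k : ℕ} (hk : k ≤ n) :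
    c k = (x n k : ℂ) := by
  have h1 := h.eq_scasimir hn
  rw [scasimir, ← sub_eq_zero, ← Finset.sum_sub_distrib] at h1
  have h2 : ∑ k ∈ Finset.range (n + 1), (c k - (x n k : ℂ)) • A n (n - k) = 0 := by
    rw [← h1]
    exact Finset.sum_congr rfl fun k _ => by module
  exact sub_eq_zero.1 (coeff_eq_zero_of_sum_smul_A (c := fun k => c k - (x n k : ℂ)) h2 hk)

/-! ### Explicit brackets and coefficients for n ≤ 5. -/

theorem bracket_nil : bracket ([] : List (Idx n)) = 1 := by
  change ∑ s : Equiv.Perm (Fin 0), (Equiv.Perm.sign s : ℤ) • (1 : U n) = 1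
  rw [Fintype.sum_subsingleton _ 1]
  simp

theorem A_zero_right (n : ℕ) : A n 0 = 1 := by
  simp [A, pairs, bracket_nil]

theorem bracket_pair (a b : Idx n) : bracket [a, b] = σ a * σ b - σ b * σ a := by
  change ∑ s : Equiv.Perm (Fin 2), (Equiv.Perm.sign s : ℤ) •
    (List.ofFn fun i => σ ([a, b].get (s i))).prod = _
  rw [show (Finset.univ : Finset (Equiv.Perm (Fin 2))) = {1, Equiv.swap 0 1}
    by decide, Finset.sum_pair (by decide)]
  simp [sub_eq_add_neg]

theorem A_one_one : A 1 1 = bracket [Sum.inl 0, Sum.inr 0] := by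
  rw [A, show (Finset.univ : Finset (Fin 1)).powersetCard 1
      = {{0}} by decide,
    Finset.sum_singleton,
    show pairs ({0} : Finset (Fin 1)) = [Sum.inl 0, Sum.inr 0] by decide]

theorem A_two_two : A 2 2 = bracket [Sum.inl 0, Sum.inr 0, Sum.inl 1, Sum.inr 1] := by
  rw [A, show (Finset.univ : Finset (Fin 2)).powersetCard 2
      = {{0, 1}} by decide,
    Finset.sum_singleton,
    show pairs ({0, 1} : Finset (Fin 2)) = [Sum.inl 0, Sum.inr 0, Sum.inl 1, Sum.inr 1] by decide]

theorem A_two_one : A 2 1 = bracket [Sum.inl 0, Sum.inr 0]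
    + bracket [Sum.inl 1, Sum.inr 1] := by
  rw [A, show (Finset.univ : Finset (Fin 2)).powersetCard 1
      = {{0}, {1}} by decide,
    Finset.sum_pair (by decide),
    show pairs ({0} : Finset (Fin 2)) = [Sum.inl 0, Sum.inr 0] by decide,
    show pairs ({1} : Finset (Fin 2)) = [Sum.inl 1, Sum.inr 1] by decide]

theorem A_three_three : A 3 3
    = bracket [Sum.inl 0, Sum.inr 0, Sum.inl 1, Sum.inr 1, Sum.inl 2, Sum.inr 2] := by
  rw [A, show (Finset.univ : Finset (Fin 3)).powersetCard 3
      = {{0, 1, 2}} by decide,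
    Finset.sum_singleton,
    show pairs ({0, 1, 2} : Finset (Fin 3))
      = [Sum.inl 0, Sum.inr 0, Sum.inl 1, Sum.inr 1, Sum.inl 2, Sum.inr 2] by decide]

theorem A_three_two : A 3 2 = bracket [Sum.inl 0, Sum.inr 0, Sum.inl 1, Sum.inr 1]
    + bracket [Sum.inl 0, Sum.inr 0, Sum.inl 2, Sum.inr 2]
    + bracket [Sum.inl 1, Sum.inr 1, Sum.inl 2, Sum.inr 2] := by
  rw [A, show (Finset.univ : Finset (Fin 3)).powersetCard 2
      = {{0, 1}, {0, 2}, {1, 2}} by decide,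
    Finset.sum_insert (by decide), Finset.sum_pair (by decide), ← add_assoc,
    show pairs ({0, 1} : Finset (Fin 3)) = [Sum.inl 0, Sum.inr 0, Sum.inl 1, Sum.inr 1] by decide,
    show pairs ({0, 2} : Finset (Fin 3)) = [Sum.inl 0, Sum.inr 0, Sum.inl 2, Sum.inr 2] by decide,
    show pairs ({1, 2} : Finset (Fin 3)) = [Sum.inl 1, Sum.inr 1, Sum.inl 2, Sum.inr 2] by decide]

theorem A_three_one : A 3 1 = bracket [Sum.inl 0, Sum.inr 0]
    + bracket [Sum.inl 1, Sum.inr 1]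
    + bracket [Sum.inl 2, Sum.inr 2] := by
  rw [A, show (Finset.univ : Finset (Fin 3)).powersetCard 1
      = {{0}, {1}, {2}} by decide,
    Finset.sum_insert (by decide), Finset.sum_pair (by decide), ← add_assoc,
    show pairs ({0} : Finset (Fin 3)) = [Sum.inl 0, Sum.inr 0] by decide,
    show pairs ({1} : Finset (Fin 3)) = [Sum.inl 1, Sum.inr 1] by decide,
    show pairs ({2} : Finset (Fin 3)) = [Sum.inl 2, Sum.inr 2] by decide]

theorem sum_range_one {c : ℕ → ℂ} {f : ℕ → U n} {d1 : ℂ} {a0 a1 : U n}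
    (h0 : c 0 = 1) (h1 : c 1 = -d1)
    (e0 : f 0 = a0) (e1 : f 1 = a1) :
    ∑ k ∈ Finset.range (1 + 1), c k • f k
      = a0 - d1 • a1 := by
  simp only [Finset.sum_range_succ, Finset.sum_range_zero, h0, h1,
    e0, e1]
  module

theorem sum_range_two {c : ℕ → ℂ} {f : ℕ → U n} {d1 d2 : ℂ} {a0 a1 a2 : U n}
    (h0 : c 0 = 1) (h1 : c 1 = -d1) (h2 : c 2 = d2)
    (e0 : f 0 = a0) (e1 : f 1 = a1) (e2 : f 2 = a2) :
    ∑ k ∈ Finset.range (2 + 1), c k • f k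
      = a0 - d1 • a1 + d2 • a2 := by
  simp only [Finset.sum_range_succ, Finset.sum_range_zero, h0, h1, h2,
    e0, e1, e2]
  module

theorem sum_range_three {c : ℕ → ℂ} {f : ℕ → U n} {d1 d2 d3 : ℂ} {a0 a1 a2 a3 : U n}
    (h0 : c 0 = 1) (h1 : c 1 = -d1) (h2 : c 2 = d2) (h3 : c 3 = -d3)
    (e0 : f 0 = a0) (e1 : f 1 = a1) (e2 : f 2 = a2) (e3 : f 3 = a3) :
    ∑ k ∈ Finset.range (3 + 1), c k • f k
      = a0 - d1 • a1 + d2 • a2 - d3 • a3 := by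
  simp only [Finset.sum_range_succ, Finset.sum_range_zero, h0, h1, h2, h3,
    e0, e1, e2, e3]
  module

theorem sum_range_four {c : ℕ → ℂ} {f : ℕ → U n} {d1 d2 d3 d4 : ℂ} {a0 a1 a2 a3 a4 : U n}
    (h0 : c 0 = 1) (h1 : c 1 = -d1) (h2 : c 2 = d2) (h3 : c 3 = -d3) (h4 : c 4 = d4)
    (e0 : f 0 = a0) (e1 : f 1 = a1) (e2 : f 2 = a2) (e3 : f 3 = a3) (e4 : f 4 = a4) :
    ∑ k ∈ Finset.range (4 + 1), c k • f k
      = a0 - d1 • a1 + d2 • a2 - d3 • a3 + d4 • a4 := by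
  simp only [Finset.sum_range_succ, Finset.sum_range_zero, h0, h1, h2, h3, h4,
    e0, e1, e2, e3, e4]
  module

theorem sum_range_five {c : ℕ → ℂ} {f : ℕ → U n} {d1 d2 d3 d4 d5 : ℂ} {a0 a1 a2 a3 a4 a5 : U n}
    (h0 : c 0 = 1) (h1 : c 1 = -d1) (h2 : c 2 = d2) (h3 : c 3 = -d3) (h4 : c 4 = d4)
    (h5 : c 5 = -d5)
    (e0 : f 0 = a0) (e1 : f 1 = a1) (e2 : f 2 = a2) (e3 : f 3 = a3) (e4 : f 4 = a4)
    (e5 : f 5 = a5) :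
    ∑ k ∈ Finset.range (5 + 1), c k • f k
      = a0 - d1 • a1 + d2 • a2 - d3 • a3 + d4 • a4 - d5 • a5 := by
  simp only [Finset.sum_range_succ, Finset.sum_range_zero, h0, h1, h2, h3, h4, h5,
    e0, e1, e2, e3, e4, e5]
  module

theorem x_one : (x 1 0 : ℂ) = 1 ∧ (x 1 1 : ℂ) = -(1 / 2) := by
  simp only [x_eq_oddSqCoeff, oddSqCoeff, Nat.factorial]
  norm_num

theorem scasimir_one : scasimir 1 = A 1 1 - (1 / 2 : ℂ) • A 1 0 := by
  obtain ⟨h0, h1⟩ := x_one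
  exact sum_range_one (f := fun k => A 1 (1 - k)) h0 h1
    (congrArg (A 1) (by norm_num))
    (congrArg (A 1) (by norm_num))

theorem x_two : (x 2 0 : ℂ) = 1 ∧ (x 2 1 : ℂ) = -5 ∧ (x 2 2 : ℂ) = 9 / 2 := by
  simp only [x_eq_oddSqCoeff, oddSqCoeff, Nat.factorial]
  norm_num

theorem scasimir_two : scasimir 2 = A 2 2 - (5 : ℂ) • A 2 1 + (9 / 2 : ℂ) • A 2 0 := by
  obtain ⟨h0, h1, h2⟩ := x_two
  exact sum_range_two (f := fun k => A 2 (2 - k)) h0 h1 h2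
    (congrArg (A 2) (by norm_num))
    (congrArg (A 2) (by norm_num))
    (congrArg (A 2) (by norm_num))

theorem x_three : 
    (x 3 0 : ℂ) = 1 ∧ (x 3 1 : ℂ) = -(35 / 2) ∧ (x 3 2 : ℂ) = 259 / 2
    ∧ (x 3 3 : ℂ) = -(675 / 4) := by
  simp only [x_eq_oddSqCoeff, oddSqCoeff, Nat.factorial]
  norm_num

theorem scasimir_three : scasimir 3 = A 3 3 - (35 / 2 : ℂ) • A 3 2
    + (259 / 2 : ℂ) • A 3 1 - (675 / 4 : ℂ) • A 3 0 := by
  obtain ⟨h0, h1, h2, h3⟩ := x_three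
  exact sum_range_three (f := fun k => A 3 (3 - k)) h0 h1 h2 h3
    (congrArg (A 3) (by norm_num))
    (congrArg (A 3) (by norm_num))
    (congrArg (A 3) (by norm_num))
    (congrArg (A 3) (by norm_num))

theorem x_four : 
    (x 4 0 : ℂ) = 1 ∧ (x 4 1 : ℂ) = -42 ∧ (x 4 2 : ℂ) = 987
    ∧ (x 4 3 : ℂ) = -9687 ∧ (x 4 4 : ℂ) = 33075 / 2 := by
  simp only [x_eq_oddSqCoeff, oddSqCoeff, Nat.factorial]
  norm_num

theorem scasimir_four : scasimir 4 = A 4 4 - (42 : ℂ) • A 4 3 + (987 : ℂ) • A 4 2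
    - (9687 : ℂ) • A 4 1 + (33075 / 2 : ℂ) • A 4 0 := by
  obtain ⟨h0, h1, h2, h3, h4⟩ := x_four
  exact sum_range_four (f := fun k => A 4 (4 - k)) h0 h1 h2 h3 h4
    (congrArg (A 4) (by norm_num))
    (congrArg (A 4) (by norm_num))
    (congrArg (A 4) (by norm_num))
    (congrArg (A 4) (by norm_num))
    (congrArg (A 4) (by norm_num))

theorem x_five : 
    (x 5 0 : ℂ) = 1 ∧ (x 5 1 : ℂ) = -(165 / 2) ∧ (x 5 2 : ℂ) = 4389
    ∧ (x 5 3 : ℂ) = -(259215 / 2) ∧ (x 5 4 : ℂ) = 3171663 / 2 ∧ (x 5 5 : ℂ) = -(13395375 / 4) := by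
  simp only [x_eq_oddSqCoeff, oddSqCoeff, Nat.factorial]
  norm_num

theorem scasimir_five : scasimir 5 = A 5 5 - (165 / 2 : ℂ) • A 5 4 + (4389 : ℂ) • A 5 3
    - (259215 / 2 : ℂ) • A 5 2 + (3171663 / 2 : ℂ) • A 5 1 - (13395375 / 4 : ℂ) • A 5 0 := by
  obtain ⟨h0, h1, h2, h3, h4, h5⟩ := x_five
  exact sum_range_five (f := fun k => A 5 (5 - k)) h0 h1 h2 h3 h4 h5
    (congrArg (A 5) (by norm_num))
    (congrArg (A 5) (by norm_num))
    (congrArg (A 5) (by norm_num))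
    (congrArg (A 5) (by norm_num))
    (congrArg (A 5) (by norm_num))
    (congrArg (A 5) (by norm_num))

end Osp

theorem mainTheorem7 :
    (∀ n : ℕ, 1 ≤ n →
      (∀ s : Osp.U n, Osp.IsScasimir n s ↔
        s = ∑ k ∈ Finset.range (n + 1), (Osp.x n k : ℂ) • Osp.A n (n - k)) ∧
      (∀ c : ℕ → ℂ,
        Osp.IsScasimir n (∑ k ∈ Finset.range (n + 1), c k • Osp.A n (n - k)) →
          ∀ k ≤ n, c k = (Osp.x n k : ℂ))) ∧
    (∀ s : Osp.U 1, Osp.IsScasimir 1 s →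
      s = Osp.A 1 1 - (1 / 2 : ℂ) • Osp.A 1 0 ∧
      s = Osp.bracket [Sum.inl 0, Sum.inr 0] - (1 / 2 : ℂ) • (1 : Osp.U 1) ∧
      s = Osp.σ (Sum.inl 0) * Osp.σ (Sum.inr 0) - Osp.σ (Sum.inr 0) * Osp.σ (Sum.inl 0)
        - (1 / 2 : ℂ) • (1 : Osp.U 1)) ∧
    (∀ s : Osp.U 2, Osp.IsScasimir 2 s →
      s = Osp.A 2 2 - (5 : ℂ) • Osp.A 2 1 + (9 / 2 : ℂ) • Osp.A 2 0 ∧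
      s = Osp.bracket [Sum.inl 0, Sum.inr 0, Sum.inl 1, Sum.inr 1]
        - (5 : ℂ) • (Osp.bracket [Sum.inl 0, Sum.inr 0] + Osp.bracket [Sum.inl 1, Sum.inr 1])
        + (9 / 2 : ℂ) • (1 : Osp.U 2)) ∧
    (∀ s : Osp.U 3, Osp.IsScasimir 3 s →
      s = Osp.A 3 3 - (35 / 2 : ℂ) • Osp.A 3 2 + (259 / 2 : ℂ) • Osp.A 3 1
        - (675 / 4 : ℂ) • Osp.A 3 0 ∧
      s = Osp.bracket [Sum.inl 0, Sum.inr 0, Sum.inl 1, Sum.inr 1, Sum.inl 2, Sum.inr 2]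
        - (35 / 2 : ℂ) • (Osp.bracket [Sum.inl 0, Sum.inr 0, Sum.inl 1, Sum.inr 1]
          + Osp.bracket [Sum.inl 0, Sum.inr 0, Sum.inl 2, Sum.inr 2]
          + Osp.bracket [Sum.inl 1, Sum.inr 1, Sum.inl 2, Sum.inr 2])
        + (259 / 2 : ℂ) • (Osp.bracket [Sum.inl 0, Sum.inr 0]
          + Osp.bracket [Sum.inl 1, Sum.inr 1] + Osp.bracket [Sum.inl 2, Sum.inr 2])
        - (675 / 4 : ℂ) • (1 : Osp.U 3)) ∧
    (∀ s : Osp.U 4, Osp.IsScasimir 4 s →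
      s = Osp.A 4 4 - (42 : ℂ) • Osp.A 4 3 + (987 : ℂ) • Osp.A 4 2 - (9687 : ℂ) • Osp.A 4 1
        + (33075 / 2 : ℂ) • Osp.A 4 0) ∧
    (∀ s : Osp.U 5, Osp.IsScasimir 5 s →
      s = Osp.A 5 5 - (165 / 2 : ℂ) • Osp.A 5 4 + (4389 : ℂ) • Osp.A 5 3
        - (259215 / 2 : ℂ) • Osp.A 5 2 + (3171663 / 2 : ℂ) • Osp.A 5 1
        - (13395375 / 4 : ℂ) • Osp.A 5 0) := by
  refine ⟨fun n hn => ⟨fun s => ⟨fun h => h.eq_scasimir hn, ?_⟩, fun c h k hk => h.coeff_eq hn hk⟩,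
    fun s h => ?_, fun s h => ?_, fun s h => ?_, fun s h => ?_, fun s h => ?_⟩
  · rintro rfl
    exact Osp.isScasimir_scasimir hn
  · have hs := h.eq_scasimir le_rfl
    rw [Osp.scasimir_one] at hs
    refine ⟨hs, ?_, ?_⟩
    · rw [hs, Osp.A_one_one, Osp.A_zero_right]
    · rw [hs, Osp.A_one_one, Osp.A_zero_right, Osp.bracket_pair]
  · have hs := h.eq_scasimir (by norm_num)
    rw [Osp.scasimir_two] at hs
    refine ⟨hs, ?_⟩
    rw [hs, Osp.A_two_two, Osp.A_two_one, Osp.A_zero_right]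
  · have hs := h.eq_scasimir (by norm_num)
    rw [Osp.scasimir_three] at hs
    refine ⟨hs, ?_⟩
    rw [hs, Osp.A_three_three, Osp.A_three_two, Osp.A_three_one, Osp.A_zero_right]
  · rw [h.eq_scasimir (by norm_num), Osp.scasimir_four]
  · rw [h.eq_scasimir (by norm_num), Osp.scasimir_five]
end
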